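/- **Setting.** Let $\mathbb R^n$ carry the Euclidean norm. Let $X\subseteq\mathbb R^n$ be closed and convex, let $f:X\to\mathbb R$ be differentiable with $\|\nabla f(y)-\nabla f(x)\|\le L\|y-x\|$ on $X$, $L>0$, let $h:X\to\mathbb R$ be convex, and suppose that $\Psi=f+h$ is bounded below on $X$; put $\Psi^*=\inf_X\Psi$. Let $\omega:X\to\mathbb R$ be continuously differentiable with $\langle x-z,\nabla\omega(x)-\nabla\omega(z)\rangle\ge\alpha\|x-z\|^2$ on $X$, $\alpha>0$, and $V(x,z)=\omega(x)-\omega(z)-\langle\nabla\omega(z),x-z\rangle$. Assume that the problem $\min_{u\in X}\{\langle g,u\rangle+\frac1\gamma V(u,x)+h(u)\}$ has a solution, denoted $x^+$, for all $\gamma>0$, $g\in\mathbb R^n$, $x\in X$. Put $P_X(x,g,\gamma)=(x-x^+)/\gamma$, $\gamma=\alpha/(2L)$ and $g_X(x)=P_X(x,\nabla f(x),\gamma)$. Fix $x_1\in X$, $\sigma>0$, $\tilde D>0$, put $D_\Psi=[(\Psi(x_1)-\Psi^*)/L]^{1/2}$ and, for integers $\bar N\ge1$, $$m=\Big\lceil\min\Big\{\max\Big\{1,\tfrac{\sigma\sqrt{6\bar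 N}}{4L\tilde D}\Big\},\bar N\Big\}\Big\rceil,\qquad N=\lfloor\bar N/m\rfloor,$$ $$\mathcal B_{\bar N}=\frac{16LD_\Psi^2}{\bar N}+\frac{4\sqrt6\,\sigma}{\sqrt{\bar N}}\Big(\frac{D_\Psi^2}{\tilde D}+\tilde D\max\Big\{1,\frac{\sqrt6\,\sigma}{4L\tilde D\sqrt{\bar N}}\Big\}\Big).$$ **Algorithm (2-RSPG with input $x_1,S,\bar N,T$).** A call of the stochastic oracle at $x$ returns $G(x,\xi)$, with $G$ Borel and $\xi$ random. *Optimization phase:* make $S$ independent runs $s=1,\dots,S$ of the following. Draw $R_s\in\{1,\dots,N\}$, independent of the noises of the run, with $\Pr\{R_s=k\}=(\alpha\gamma_k-L\gamma_k^2)/\sum_{j=1}^N(\alpha\gamma_j-L\gamma_j^2)$, $\gamma_k=\gamma$; starting from $x_1$, for $k=1,\dots,R_s-1$ let $x_{k+1}$ be the minimizer over $u\in X$ of $\langle G_k,u\rangle+\frac1{\gamma_k}V(u,x_k)+h(u)$, where $G_k$ is the average of $m$ oracle answers at $x_k$; the output of the run is $\bar x_s=x_{R_s}$. *Post-optimization phase:*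 with $\bar G_T(\bar x_s)$ the average of $T$ oracle answers at $\bar x_s$ (the samples may be shared between different $s$ or not), return $\bar x^*\in\{\bar x_1,\dots,\bar x_S\}$ minimizing $\|P_X(\bar x_s,\bar G_T(\bar x_s),\gamma)\|$. **Assumptions.** For every oracle call, at a point $x$ with noise $\xi$ (in the runs, for all iterations $k\le N$), let $\delta=G(x,\xi)-\nabla f(x)$, and let $\mathcal H$ be generated by the earlier noises of the same run (for a call in the post-optimization phase at $\bar x_s$: by the whole optimization phase and the earlier samples taken at $\bar x_s$). A1: $\mathbb E[\delta\mid\mathcal H]=0$ and $\mathbb E\|\delta\|^2\le\sigma^2$. A2: $\mathbb E[\exp(\|\delta\|^2/\sigma^2)\mid\mathcal H]\le\exp(1)$ almost surely. **Statement.** Under A1 and A2 the following hold. (a) For all integers $S,\bar N,T\ge1$ and all $\lambda>0$, $$\Pr\Big\{\|g_X(\bar x^*)\|^2\ge\frac{8L\mathcal B_{\bar N}}{\alpha^2}+\frac{12(1+\lambda)^2\sigma^2}{T\alpha^2}\Big\}\le S\exp(-\lambda^2/3)+2^{-S}.$$ (b) Let $\varepsilon>0$, $\Lambda\in(0,1)$,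 and take $S=S(\Lambda)=\lceil\log_2(2/\Lambda)\rceil$, $$\bar N=\bar N(\varepsilon)=\Big\lceil\max\Big\{\frac{512L^2D_\Psi^2}{\alpha^2\varepsilon},\Big[\Big(\tilde D+\frac{D_\Psi^2}{\tilde D}\Big)\frac{128\sqrt6\,L\sigma}{\alpha^2\varepsilon}\Big]^2,\frac{3\sigma^2}{8L^2\tilde D^2}\Big\}\Big\rceil,$$ $$T=T'(\varepsilon,\Lambda)=\Big\lceil\frac{24\sigma^2}{\alpha^2\varepsilon}\Big[1+\Big(3\log_2\frac{2S(\Lambda)}{\Lambda}\Big)^{1/2}\Big]^2\Big\rceil.$$ Then $\bar x^*$ is an $(\varepsilon,\Lambda)$-solution, i.e. $\bar x^*\in X$ and $\Pr\{\|g_X(\bar x^*)\|^2\le\varepsilon\}\ge1-\Lambda$, and the algorithm makes at most $S(\Lambda)[\bar N(\varepsilon)+T'(\varepsilon,\Lambda)]$ oracle calls. (c) This number of calls depends on $1/\Lambda$ only through logarithms: there is a constant $C>0$ depending only on the problem data $(X,f,h,\omega)$ with their constants $L$ and $\alpha$, on $x_1$ and on $\tilde D$ (not on $\sigma,\varepsilon,\Lambda$),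 such that for all $\sigma>0$, $\varepsilon\in(0,1]$, $\Lambda\in(0,\frac12]$, $$S(\Lambda)[\bar N(\varepsilon)+T'(\varepsilon,\Lambda)]\le C\Big\{\frac1\varepsilon\log_2\frac1\Lambda+\frac{\sigma^2}{\varepsilon^2}\log_2\frac1\Lambda+\frac{\sigma^2}{\varepsilon}\log_2^2\frac1\Lambda\Big\}.$$ -/

import Mathlib

open MeasureTheory ProbabilityTheory

noncomputable section

/-- `ℝⁿ` with its Euclidean norm and inner product. -/
abbrev Vec (n : ℕ) : Type := EuclideanSpace ℝ (Fin n)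

/-- The prox-function `V(x, z) = ω(x) - [ω(z) + ⟨∇ω(z), x - z⟩]`. -/
def proxFun {n : ℕ} (ω : Vec n → ℝ) (gradω : Vec n → Vec n) (x z : Vec n) : ℝ :=
  ω x - (ω z + inner ℝ (gradω z) (x - z))

/-- The objective `u ↦ ⟨g, u⟩ + V(u, x) / γ + h(u)` of the generalized projection problem. -/
def projObjective {n : ℕ} (ω : Vec n → ℝ) (gradω : Vec n → Vec n) (h : Vec n → ℝ)
    (x g : Vec n) (γ : ℝ) (u : Vec n) : ℝ :=
  inner ℝ g u + (1 / γ) * proxFun ω gradω u x + h u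

/-- The composite problem `min {f(x) + h(x) : x ∈ X}` together with a distance generating
function `ω`. Only the values on `X` of the functions matter. The maps `gradf`, `gradω` are the
gradients (relative to `X`) of `f`, `ω`. -/
structure CompositeProblem (n : ℕ) where
  X : Set (Vec n)
  isClosed_X : IsClosed X
  convex_X : Convex ℝ X
  f : Vec n → ℝ
  gradf : Vec n → Vec n
  hasGradient_f : ∀ x ∈ X, HasGradientWithinAt f (gradf x) X x
  L : ℝ
  L_pos : 0 < L
  lipschitz_gradf : ∀ x ∈ X, ∀ y ∈ X, ‖gradf y - gradf x‖ ≤ L * ‖y - x‖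
  h : Vec n → ℝ
  convex_h : ConvexOn ℝ X h
  bddBelow : BddBelow ((fun x => f x + h x) '' X)
  ω : Vec n → ℝ
  gradω : Vec n → Vec n
  hasGradient_ω : ∀ x ∈ X, HasGradientWithinAt ω (gradω x) X x
  continuousOn_gradω : ContinuousOn gradω X
  α : ℝ
  α_pos : 0 < α
  strong_ω : ∀ x ∈ X, ∀ z ∈ X, α * ‖x - z‖ ^ 2 ≤ inner ℝ (x - z) (gradω x - gradω z)
  /-- The generalized projection problem is solvable for all `γ > 0`, `g`, and `x ∈ X`. -/
  solvable : ∀ γ : ℝ, 0 < γ → ∀ g : Vec n, ∀ x ∈ X,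
    ∃ u ∈ X, IsMinOn (projObjective ω gradω h x g γ) X u

namespace CompositeProblem

variable {n : ℕ} (P : CompositeProblem n)

/-- The composite objective `Ψ = f + h`. -/
def Psi (x : Vec n) : ℝ := P.f x + P.h x

/-- The optimal value `Ψ* = inf {Ψ(x) : x ∈ X}`. -/
def PsiStar : ℝ := sInf (P.Psi '' P.X)

/-- `D_Ψ = ((Ψ(x₁) - Ψ*) / L)^{1/2}`. -/
def DPsi (x₁ : Vec n) : ℝ := Real.sqrt ((P.Psi x₁ - P.PsiStar) / P.L)

/-- The generalized projection: the minimizer over `X` of `⟨g, u⟩ + V(u, x) / γ + h(u)`. -/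
def proj (x g : Vec n) (γ : ℝ) : Vec n :=
  Classical.epsilon fun u => u ∈ P.X ∧ IsMinOn (projObjective P.ω P.gradω P.h x g γ) P.X u

/-- `P_X(x, g, γ) = (x - x⁺) / γ`. -/
def PX (x g : Vec n) (γ : ℝ) : Vec n := (1 / γ) • (x - P.proj x g γ)

/-- The stepsizes `γ_k = α / (2L)`. -/
def step (_k : ℕ) : ℝ := P.α / (2 * P.L)

/-- The projected gradient `g_X(x) = P_X(x, ∇f(x), γ)`, with `γ = α / (2L)`. -/
def gX (x : Vec n) : Vec n := P.PX x (P.gradf x) (P.α / (2 * P.L))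

/-- `𝓑_{N̄}`. -/
def BN (σ Dt : ℝ) (x₁ : Vec n) (Nbar : ℕ) : ℝ :=
  16 * P.L * P.DPsi x₁ ^ 2 / Nbar
    + 4 * Real.sqrt 6 * σ / Real.sqrt Nbar
      * (P.DPsi x₁ ^ 2 / Dt
          + Dt * max 1 (Real.sqrt 6 * σ / (4 * P.L * Dt * Real.sqrt Nbar)))

/-- The batch size `m = ⌈min {max {1, σ √(6 N̄) / (4 L D̃)}, N̄}⌉`. -/
def batchSize (σ Dt : ℝ) (Nbar : ℕ) : ℕ :=
  ⌈min (max 1 (σ * Real.sqrt (6 * Nbar) / (4 * P.L * Dt))) (Nbar : ℝ)⌉₊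

/-- The iteration limit `N = ⌊N̄ / m⌋`. -/
def iterLimit (σ Dt : ℝ) (Nbar : ℕ) : ℕ := Nbar / P.batchSize σ Dt Nbar

/-- The probability mass function
`P_R(k) = (α γ_k - L γ_k²) / ∑_{j=1}^N (α γ_j - L γ_j²)` on `{1, …, N}`. -/
def massR (γ : ℕ → ℝ) (N k : ℕ) : ℝ :=
  (P.α * γ k - P.L * γ k ^ 2) / ∑ j ∈ Finset.Icc 1 N, (P.α * γ j - P.L * γ j ^ 2)

/-- The number of calls `N̄(ε)` per run. -/
def NbarOf (σ Dt : ℝ) (x₁ : Vec n) (ε : ℝ) : ℕ :=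
  ⌈max (max (512 * P.L ^ 2 * P.DPsi x₁ ^ 2 / (P.α ^ 2 * ε))
        (((Dt + P.DPsi x₁ ^ 2 / Dt) * (128 * Real.sqrt 6 * P.L * σ / (P.α ^ 2 * ε))) ^ 2))
      (3 * σ ^ 2 / (8 * P.L ^ 2 * Dt ^ 2))⌉₊

end CompositeProblem

/-- The number of runs `S(Λ) = ⌈log₂ (2 / Λ)⌉`. -/
def SOf (Lam : ℝ) : ℕ := ⌈Real.logb 2 (2 / Lam)⌉₊

/-- The sample size `T'(ε, Λ) = ⌈(24 σ² / (α² ε)) [1 + (3 log₂ (2 S(Λ) / Λ))^{1/2}]²⌉`. -/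
def TPrimeOf (α σ ε Lam : ℝ) : ℕ :=
  ⌈24 * σ ^ 2 / (α ^ 2 * ε) * (1 + Real.sqrt (3 * Real.logb 2 (2 * SOf Lam / Lam))) ^ 2⌉₊

/-- The average `(1 / m) ∑_{i=1}^m G(x, ξ_i)` of `m` oracle answers at `x`. -/
def sampleMean {n : ℕ} {Ξ : Type*} (G : Vec n → Ξ → Vec n) (m : ℕ) (x : Vec n) (ξ : ℕ → Ξ) :
    Vec n :=
  (1 / (m : ℝ)) • ∑ i ∈ Finset.Icc 1 m, G x (ξ i)

/-- The iterates `x_1, x_2, …` of the RSPG algorithm, as a function of the array of noises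
`ξ k i`, `k, i ≥ 1` (index `0` is a dummy). -/
def rspgIterate {n : ℕ} {Ξ : Type*} (P : CompositeProblem n) (G : Vec n → Ξ → Vec n)
    (γ : ℕ → ℝ) (m : ℕ → ℕ) (x₁ : Vec n) (ξ : ℕ → ℕ → Ξ) : ℕ → Vec n
  | 0 => x₁
  | 1 => x₁
  | k + 2 =>
      P.proj (rspgIterate P G γ m x₁ ξ (k + 1))
        (sampleMean G (m (k + 1)) (rspgIterate P G γ m x₁ ξ (k + 1)) (ξ (k + 1))) (γ (k + 1))

/-- Number of oracle calls of a run of RSPG stopped at `R = r`: `m_k` calls in each of the steps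
`k = 1, …, r - 1`. -/
def rspgCalls (m : ℕ → ℕ) (r : ℕ) : ℕ := ∑ k ∈ Finset.Icc 1 (r - 1), m k

/-- The information before the call `(k, i)` of a run with batch size `m`: the noises of the
calls `(j, l)` with `j < k`, and of the calls `(k, l)` with `l < i`. -/
@[reducible] def runHistory {Ω Ξ : Type*} [MeasurableSpace Ξ] (m : ℕ) (ξ : ℕ → ℕ → Ω → Ξ) (k i : ℕ) :
    MeasurableSpace Ω :=
  ⨆ (j : ℕ) (l : ℕ) (_ : (1 ≤ j ∧ j < k ∧ 1 ≤ l ∧ l ≤ m) ∨ (j = k ∧ 1 ≤ l ∧ l < i)),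
    MeasurableSpace.comap (ξ j l) inferInstance

/-- The information carried by all the noises `ξ k i`, `1 ≤ k ≤ N`, `1 ≤ i ≤ m`, of a run. -/
@[reducible] def runNoise {Ω Ξ : Type*} [MeasurableSpace Ξ] (N m : ℕ) (ξ : ℕ → ℕ → Ω → Ξ) :
    MeasurableSpace Ω :=
  ⨆ (k : ℕ) (i : ℕ) (_ : 1 ≤ k ∧ k ≤ N ∧ 1 ≤ i ∧ i ≤ m),
    MeasurableSpace.comap (ξ k i) inferInstance

/-- An execution, on a probability space `(Ω, μ)`, of the two-phase RSPG algorithm with input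
`x₁, S, N̄, T`. -/
structure TwoRSPG {n : ℕ} {Ξ : Type*} [MeasurableSpace Ξ] (P : CompositeProblem n)
    (G : Vec n → Ξ → Vec n) (σ Dt : ℝ) (x₁ : Vec n) (Nbar S T : ℕ)
    {Ω : Type*} [MeasurableSpace Ω] (μ : Measure Ω) where
  /-- `R s` is the random stopping index of run `s`. -/
  R : Fin S → Ω → ℕ
  /-- `ξ s k i` is the noise of the `i`-th oracle call at iteration `k` of run `s`. -/
  ξ : Fin S → ℕ → ℕ → Ω → Ξ
  /-- `ζ s t` is the noise of the `t`-th call at the candidate `s` in the post-optimization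
  phase. Nothing is required of the joint law for different `s`: the samples may be shared by
  the candidates, or drawn anew for each of them. -/
  ζ : Fin S → ℕ → Ω → Ξ
  /-- The index of the candidate that is returned. -/
  sel : Ω → Fin S
  measurable_R : ∀ s, Measurable (R s)
  measurable_ξ : ∀ s k i, Measurable (ξ s k i)
  measurable_ζ : ∀ s t, Measurable (ζ s t)
  measurable_sel : Measurable sel
  R_mem : ∀ s ω, R s ω ∈ Finset.Icc 1 (P.iterLimit σ Dt Nbar)
  law_R : ∀ s, ∀ k ∈ Finset.Icc 1 (P.iterLimit σ Dt Nbar),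
    μ.real {ω | R s ω = k} = P.massR P.step (P.iterLimit σ Dt Nbar) k
  /-- The stopping index of a run is independent of its noises. -/
  indep_R : ∀ s, Indep (MeasurableSpace.comap (R s) inferInstance)
    (runNoise (P.iterLimit σ Dt Nbar) (P.batchSize σ Dt Nbar) (ξ s)) μ
  /-- The `S` runs are independent. -/
  indep_runs : iIndep (fun s => MeasurableSpace.comap (R s) inferInstance ⊔
    runNoise (P.iterLimit σ Dt Nbar) (P.batchSize σ Dt Nbar) (ξ s)) μ
  /-- The returned candidate has a smallest `‖ḡ_X‖` among the candidates. -/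
  sel_min : ∀ ω s,
    let xbar := fun s => rspgIterate P G P.step (fun _ => P.batchSize σ Dt Nbar) x₁
      (fun k i => ξ s k i ω) (R s ω)
    let gbar := fun s => P.PX (xbar s) (sampleMean G T (xbar s) (fun t => ζ s t ω))
      (P.step (R s ω))
    ‖gbar (sel ω)‖ ≤ ‖gbar s‖

namespace TwoRSPG

variable {n : ℕ} {Ξ : Type*} [MeasurableSpace Ξ] {P : CompositeProblem n}
  {G : Vec n → Ξ → Vec n} {σ Dt : ℝ} {x₁ : Vec n} {Nbar S T : ℕ}
  {Ω : Type*} [MeasurableSpace Ω] {μ : Measure Ω} (A : TwoRSPG P G σ Dt x₁ Nbar S T μ)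

/-- The `k`-th iterate of run `s`. -/
def iterate (s : Fin S) (k : ℕ) (ω : Ω) : Vec n :=
  rspgIterate P G P.step (fun _ => P.batchSize σ Dt Nbar) x₁ (fun k i => A.ξ s k i ω) k

/-- The candidate `x̄_s = x_{R_s}`. -/
def candidate (s : Fin S) (ω : Ω) : Vec n := A.iterate s (A.R s ω) ω

/-- The output `x̄*`. -/
def output (ω : Ω) : Vec n := A.candidate (A.sel ω) ω

/-- The total number of oracle calls: those of the `S` runs of RSPG, and `T` for each
candidate. -/
def calls (ω : Ω) : ℕ :=
  ∑ s : Fin S, rspgCalls (fun _ => P.batchSize σ Dt Nbar) (A.R s ω) + ∑ _s : Fin S, T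

/-- The error `G(x_k, ξ_{k,i}) - ∇f(x_k)` of a call in run `s`. -/
def runError (s : Fin S) (k i : ℕ) (ω : Ω) : Vec n :=
  G (A.iterate s k ω) (A.ξ s k i ω) - P.gradf (A.iterate s k ω)

/-- The error `G(x̄_s, ζ_{s,t}) - ∇f(x̄_s)` of a call in the post-optimization phase. -/
def postError (s : Fin S) (t : ℕ) (ω : Ω) : Vec n :=
  G (A.candidate s ω) (A.ζ s t ω) - P.gradf (A.candidate s ω)

/-- The information before the `t`-th call at candidate `s`: the whole optimization phase and
the earlier samples taken at this candidate. -/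
@[reducible] def postHistory (s : Fin S) (t : ℕ) : MeasurableSpace Ω :=
  (⨆ s' : Fin S, MeasurableSpace.comap (A.R s') inferInstance ⊔
    runNoise (P.iterLimit σ Dt Nbar) (P.batchSize σ Dt Nbar) (A.ξ s')) ⊔
  ⨆ (u : ℕ) (_ : 1 ≤ u ∧ u < t), MeasurableSpace.comap (A.ζ s u) inferInstance

end TwoRSPG

/-- A1 for one oracle call with error `δ` and history `m`: the answer is unbiased given the
history, and its error has second moment at most `σ²`. -/
def CallA1 {n : ℕ} {Ω : Type*} [MeasurableSpace Ω] (μ : Measure Ω) (m : MeasurableSpace Ω)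
    (σ : ℝ) (δ : Ω → Vec n) : Prop :=
  (Integrable δ μ ∧ μ[δ | m] =ᵐ[μ] 0) ∧
  (Integrable (fun ω => ‖δ ω‖ ^ 2) μ ∧ ∫ ω, ‖δ ω‖ ^ 2 ∂μ ≤ σ ^ 2)

/-- A2 for one oracle call with error `δ` and history `m`:
`E[exp(‖δ‖² / σ²) | m] ≤ exp(1)` almost surely. -/
def CallA2 {n : ℕ} {Ω : Type*} [MeasurableSpace Ω] (μ : Measure Ω) (m : MeasurableSpace Ω)
    (σ : ℝ) (δ : Ω → Vec n) : Prop :=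
  Integrable (fun ω => Real.exp (‖δ ω‖ ^ 2 / σ ^ 2)) μ ∧
  ∀ᵐ ω ∂μ, (μ[fun ω => Real.exp (‖δ ω‖ ^ 2 / σ ^ 2) | m]) ω ≤ Real.exp 1

namespace TwoRSPG

variable {n : ℕ} {Ξ : Type*} [MeasurableSpace Ξ] {P : CompositeProblem n}
  {G : Vec n → Ξ → Vec n} {σ Dt : ℝ} {x₁ : Vec n} {Nbar S T : ℕ}
  {Ω : Type*} [MeasurableSpace Ω] {μ : Measure Ω} (A : TwoRSPG P G σ Dt x₁ Nbar S T μ)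

/-- Assumption A1 for all the oracle calls of the execution. -/
def AssumptionA1 : Prop :=
  (∀ s, ∀ k ∈ Finset.Icc 1 (P.iterLimit σ Dt Nbar), ∀ i ∈ Finset.Icc 1 (P.batchSize σ Dt Nbar),
    CallA1 μ (runHistory (P.batchSize σ Dt Nbar) (A.ξ s) k i) σ (A.runError s k i)) ∧
  (∀ s, ∀ t ∈ Finset.Icc 1 T, CallA1 μ (A.postHistory s t) σ (A.postError s t))

/-- Assumption A2 for all the oracle calls of the execution. -/
def AssumptionA2 : Prop :=
  (∀ s, ∀ k ∈ Finset.Icc 1 (P.iterLimit σ Dt Nbar), ∀ i ∈ Finset.Icc 1 (P.batchSize σ Dt Nbar),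
    CallA2 μ (runHistory (P.batchSize σ Dt Nbar) (A.ξ s) k i) σ (A.runError s k i)) ∧
  (∀ s, ∀ t ∈ Finset.Icc 1 T, CallA2 μ (A.postHistory s t) σ (A.postError s t))

end TwoRSPG

/-- The random point `x` is an `(ε, Λ)`-solution: `x ∈ X` and
`Prob{‖g_X(x)‖² ≤ ε} ≥ 1 - Λ`. -/
def IsEpsLamSolution {n : ℕ} (P : CompositeProblem n) {Ω : Type*} [MeasurableSpace Ω]
    (μ : Measure Ω) (x : Ω → Vec n) (ε Lam : ℝ) : Prop :=
  (∀ ω, x ω ∈ P.X) ∧ 1 - Lam ≤ μ.real {ω | ‖P.gX (x ω)‖ ^ 2 ≤ ε}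

end

/-! A prox step with an inexact gradient lowers `Psi`. The descent inequality for `f`, the
optimality condition of the projection and the strong monotonicity of ∇ω bound the decrease below by
a multiple of ‖P_X(x,g,γ)‖², up to the inner product of the gradient error with P_X. As P_X is
1/α-Lipschitz in g, it can be traded for g_X(x) at the price of a multiple of the squared error
(`Psi_proj_add_le`). No martingale term survives, so telescoping bounds the sum of ‖g_X(x_k)‖² path
by path (`sum_norm_gX_sq_le`). Averaging m answers leaves a mean squared error of at most σ²/m,
because martingale differences are orthogonal. The constant stepsize makes R uniform, R is
independent of the noises, and the average over k of E‖g_X(x_k)‖² is at most L𝓑/α²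
(`run_bound_le_BN`). Markov's inequality at twice this value and the independence of the runs show
that all candidates fail with probability at most 2^(-S).

The post-optimization phase rests on a tail bound for sums of vector martingale differences
(`measureReal_norm_sum_sq_ge_le`). The norm is replaced by the smooth majorant √(‖·‖² + β²), whose
growth is at most a scalar martingale difference plus a quadratic remainder. The first has
subgaussian exponential moments through e^x ≤ x + e^(3x²/4), the second is controlled by A2
directly.

If one candidate is good and every averaged gradient is accurate, triangle inequalities carry the
quality through the selection (`norm_gX_output_sq_lt`), and a union bound gives (a). Parts (b) and
(c) are the choice of parameters, each of the two error terms receiving ε/2 and each of the two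
failure probabilities Λ/2. -/

/-- A function continuous on a measurable set is measurable along measurable maps into the set. -/
theorem ContinuousOn.measurable_comp_of_mapsTo {Ω E F : Type*} {m : MeasurableSpace Ω}
    [TopologicalSpace E] [MeasurableSpace E] [BorelSpace E] [TopologicalSpace F]
    [MeasurableSpace F] [BorelSpace F] {s : Set E} {φ : E → F} (hφ : ContinuousOn φ s)
    {y : Ω → E} (hy : Measurable y) (hs : ∀ ω, y ω ∈ s) : Measurable (fun ω => φ (y ω)) :=
  (continuousOn_iff_continuous_domRestrict.1 hφ).measurable.comp (hy.subtype_mk (h := hs))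

theorem HasGradientWithinAt.hasDerivWithinAt_line {n : ℕ} {X : Set (Vec n)} {F : Vec n → ℝ}
    {g p v : Vec n} {t : ℝ} (hF : HasGradientWithinAt F g X (p + t • v))
    (hX : ∀ s ∈ Set.Icc (0 : ℝ) 1, p + s • v ∈ X) :
    HasDerivWithinAt (fun s : ℝ => F (p + s • v)) (inner ℝ g v) (Set.Icc 0 1) t := by
  have h1 : HasDerivWithinAt (fun s : ℝ => p + s • v) v (Set.Icc 0 1) t := by
    simpa using (((hasDerivAt_id t).smul_const v).const_add p).hasDerivWithinAt
  exact (hF.hasFDerivWithinAt.comp_hasDerivWithinAt t h1 hX).congr_deriv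
    (InnerProductSpace.toDual_apply_apply ..)

/-! ### The generalized projection and the decrease of Ψ in one step -/

namespace CompositeProblem

variable {n : ℕ} (P : CompositeProblem n)

theorem segment_mem {x y : Vec n} (hx : x ∈ P.X) (hy : y ∈ P.X) {t : ℝ}
    (ht : t ∈ Set.Icc (0 : ℝ) 1) : x + t • (y - x) ∈ P.X := by
  have := P.convex_X hx hy (sub_nonneg.2 ht.2) ht.1 (by ring)
  convert this using 1
  module

/-- The descent inequality for a function with Lipschitz gradient on a convex set. -/
theorem f_le {x y : Vec n} (hx : x ∈ P.X) (hy : y ∈ P.X) :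
    P.f y ≤ P.f x + inner ℝ (P.gradf x) (y - x) + P.L / 2 * ‖y - x‖ ^ 2 := by
  set v := y - x with hv
  have hseg : ∀ s ∈ Set.Icc (0 : ℝ) 1, x + s • v ∈ P.X := fun s hs => P.segment_mem hx hy hs
  -- The derivative of φ is at most 0 by the Lipschitz bound on ∇f along the segment; comparing φ(1)
  -- with φ(0) is the claim.
  let φ : ℝ → ℝ := fun t =>
    P.f (x + t • v) - t * inner ℝ (P.gradf x) v - P.L / 2 * ‖v‖ ^ 2 * t ^ 2
  have hd : ∀ t ∈ Set.Icc (0 : ℝ) 1, HasDerivWithinAt φ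
      (inner ℝ (P.gradf (x + t • v)) v - inner ℝ (P.gradf x) v - P.L * ‖v‖ ^ 2 * t)
      (Set.Icc 0 1) t := by
    intro t ht
    have h1 := (P.hasGradient_f _ (hseg t ht)).hasDerivWithinAt_line hseg
    have h2 := (((hasDerivAt_id t).mul_const (inner ℝ (P.gradf x) v)).hasDerivWithinAt
      (s := Set.Icc 0 1))
    have h3 := (((hasDerivAt_pow 2 t).const_mul (P.L / 2 * ‖v‖ ^ 2)).hasDerivWithinAt
      (s := Set.Icc 0 1))
    refine ((h1.sub h2).sub h3).congr_deriv ?_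
    norm_num
    ring
  have hanti : AntitoneOn φ (Set.Icc 0 1) := by
    refine antitoneOn_of_hasDerivWithinAt_nonpos (convex_Icc 0 1)
      (fun t ht => (hd t ht).continuousWithinAt)
      (fun t ht => (hd t (interior_subset ht)).mono interior_subset) ?_
    intro t ht
    have ht' := interior_subset ht
    rw [← inner_sub_left]
    have h4 := P.lipschitz_gradf x hx _ (hseg t ht')
    have h5 := real_inner_le_norm (P.gradf (x + t • v) - P.gradf x) v
    rw [add_sub_cancel_left, norm_smul, Real.norm_eq_abs, abs_of_nonneg ht'.1] at h4
    nlinarith [norm_nonneg v]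
  have := hanti (Set.left_mem_Icc.2 zero_le_one) (Set.right_mem_Icc.2 zero_le_one) zero_le_one
  simp only [φ, zero_smul, one_smul, add_zero, hv, add_sub_cancel] at this
  linarith

theorem proj_spec {γ : ℝ} (hγ : 0 < γ) {x : Vec n} (hx : x ∈ P.X) (g : Vec n) :
    P.proj x g γ ∈ P.X ∧
      IsMinOn (projObjective P.ω P.gradω P.h x g γ) P.X (P.proj x g γ) :=
  Classical.epsilon_spec (P.solvable γ hγ g x hx)

/-- The optimality condition of the generalized projection problem. -/
theorem proj_optimality {γ : ℝ} (hγ : 0 < γ) {x : Vec n} (hx : x ∈ P.X) (g : Vec n)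
    {u : Vec n} (hu : u ∈ P.X) :
    0 ≤ inner ℝ (γ • g + P.gradω (P.proj x g γ) - P.gradω x) (u - P.proj x g γ)
      + γ * (P.h u - P.h (P.proj x g γ)) := by
  obtain ⟨hp, hmin⟩ := P.proj_spec hγ hx g
  set p := P.proj x g γ with hpdef
  set v := u - p with hv
  have hseg : ∀ s ∈ Set.Icc (0 : ℝ) 1, p + s • v ∈ P.X := fun s hs => P.segment_mem hp hu hs
  have h0 : (0 : ℝ) ∈ Set.Icc (0 : ℝ) 1 := Set.left_mem_Icc.2 zero_le_one
  -- Up to a constant, φ is γ times the objective along the segment with `h` replaced by its chord.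
  -- Convexity of `h` keeps 0 a minimizer, and φ is now differentiable.
  let φ : ℝ → ℝ := fun t =>
    P.ω (p + t • v) + t * (inner ℝ (γ • g - P.gradω x) v + γ * (P.h u - P.h p))
  have hd : HasDerivWithinAt φ
      (inner ℝ (P.gradω p) v + (inner ℝ (γ • g - P.gradω x) v + γ * (P.h u - P.h p)))
      (Set.Icc 0 1) 0 := by
    have h1 := (P.hasGradient_ω _ (hseg 0 h0)).hasDerivWithinAt_line hseg
    have h2 := (((hasDerivAt_id (0 : ℝ)).mul_const
      (inner ℝ (γ • g - P.gradω x) v + γ * (P.h u - P.h p))).hasDerivWithinAt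
      (s := Set.Icc 0 1))
    refine (h1.add h2).congr_deriv ?_
    simp
  have hφ : IsMinOn φ (Set.Icc 0 1) 0 := by
    intro t ht
    have h1 : projObjective P.ω P.gradω P.h x g γ p
        ≤ projObjective P.ω P.gradω P.h x g γ (p + t • v) := hmin (hseg t ht)
    have h2 : P.h (p + t • v) ≤ (1 - t) * P.h p + t * P.h u := by
      have := P.convex_h.2 hp hu (sub_nonneg.2 ht.2) ht.1 (by ring)
      rw [smul_eq_mul, smul_eq_mul] at this
      have e : p + t • v = (1 - t) • p + t • u := by rw [hv]; module
      rwa [e]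
    have h3 : γ * projObjective P.ω P.gradω P.h x g γ p
        ≤ γ * projObjective P.ω P.gradω P.h x g γ (p + t • v) :=
      mul_le_mul_of_nonneg_left h1 hγ.le
    have h4 : γ * P.h (p + t • v) ≤ γ * ((1 - t) * P.h p + t * P.h u) :=
      mul_le_mul_of_nonneg_left h2 hγ.le
    have h5 : p + t • v - x = (p - x) + t • v := by abel
    simp only [projObjective, proxFun, mul_add, ← mul_assoc, mul_one_div_cancel hγ.ne',
      one_mul, h5, inner_add_right, real_inner_smul_right] at h3
    simp only [Set.mem_ofPred_eq, φ, zero_smul, add_zero, zero_mul, inner_sub_left,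
      real_inner_smul_left]
    linarith
  -- The segment starts at the minimizer, so only the slopes from the right are available, and they
  -- are nonnegative.
  have hslope := hasDerivWithinAt_iff_tendsto_slope.1 hd
  have hset : Set.Icc (0 : ℝ) 1 \ {0} = Set.Ioc 0 1 := by
    ext t
    simp only [Set.mem_sdiff, Set.mem_Icc, Set.mem_singleton_iff, Set.mem_Ioc]
    constructor
    · rintro ⟨⟨a, b⟩, c⟩; exact ⟨lt_of_le_of_ne a (Ne.symm c), b⟩
    · rintro ⟨a, b⟩; exact ⟨⟨a.le, b⟩, a.ne'⟩
  rw [hset, nhdsWithin_Ioc_eq_nhdsGT zero_lt_one] at hslope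
  have hnn : 0 ≤ inner ℝ (P.gradω p) v
      + (inner ℝ (γ • g - P.gradω x) v + γ * (P.h u - P.h p)) := by
    refine ge_of_tendsto hslope ?_
    filter_upwards [Ioc_mem_nhdsGT (zero_lt_one' ℝ)] with t ht
    rw [slope_def_field]
    exact div_nonneg (sub_nonneg.2 (hφ ⟨ht.1.le, ht.2⟩)) (sub_nonneg.2 ht.1.le)
  rw [inner_sub_left] at hnn ⊢
  rw [inner_add_left]
  linarith

/-- The generalized projection depends Lipschitz continuously on `γ g - ∇ω(x)`. -/
theorem norm_proj_sub_proj_le {γ : ℝ} (hγ : 0 < γ) {x₁ x₂ : Vec n} (hx₁ : x₁ ∈ P.X)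
    (hx₂ : x₂ ∈ P.X) (g₁ g₂ : Vec n) :
    P.α * ‖P.proj x₁ g₁ γ - P.proj x₂ g₂ γ‖
      ≤ ‖(γ • g₁ - P.gradω x₁) - (γ • g₂ - P.gradω x₂)‖ := by
  have hp₁ := (P.proj_spec hγ hx₁ g₁).1
  have hp₂ := (P.proj_spec hγ hx₂ g₂).1
  -- Each optimality condition is tested at the other projection; in the sum the values of `h`
  -- cancel.
  have h1 := P.proj_optimality hγ hx₁ g₁ hp₂
  have h2 := P.proj_optimality hγ hx₂ g₂ hp₁
  have h3 := P.strong_ω _ hp₁ _ hp₂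
  set p₁ := P.proj x₁ g₁ γ
  set p₂ := P.proj x₂ g₂ γ
  have h4 := abs_real_inner_le_norm ((γ • g₁ - P.gradω x₁) - (γ • g₂ - P.gradω x₂)) (p₁ - p₂)
  have h5 : P.α * ‖p₁ - p₂‖ ^ 2
      ≤ ‖(γ • g₁ - P.gradω x₁) - (γ • g₂ - P.gradω x₂)‖ * ‖p₁ - p₂‖ := by
    refine le_trans ?_ ((neg_le_abs _).trans h4)
    rw [real_inner_comm] at h3
    simp only [inner_sub_left, inner_sub_right, inner_add_left] at h1 h2 h3 ⊢
    linarith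
  rcases (norm_nonneg (p₁ - p₂)).eq_or_lt with h6 | h6
  · rw [← h6, mul_zero]; exact norm_nonneg _
  · exact le_of_mul_le_mul_right (by linarith [h5, sq ‖p₁ - p₂‖]) h6

/-- For a common base point the ∇ω terms cancel, and the factor γ of the data cancels the 1/γ in
P_X, so the constant does not depend on γ. -/
theorem norm_PX_sub_PX_le {γ : ℝ} (hγ : 0 < γ) {x : Vec n} (hx : x ∈ P.X) (g₁ g₂ : Vec n) :
    ‖P.PX x g₁ γ - P.PX x g₂ γ‖ ≤ ‖g₁ - g₂‖ / P.α := by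
  have h := P.norm_proj_sub_proj_le hγ hx hx g₂ g₁
  rw [sub_sub_sub_cancel_right, ← smul_sub, norm_smul, Real.norm_eq_abs, abs_of_pos hγ] at h
  have h1 : P.PX x g₁ γ - P.PX x g₂ γ = (1 / γ) • (P.proj x g₂ γ - P.proj x g₁ γ) := by
    simp only [PX]; module
  rw [h1, norm_smul, Real.norm_eq_abs, abs_of_pos (by positivity), le_div_iff₀ P.α_pos,
    norm_sub_rev g₁ g₂, one_div, mul_assoc, inv_mul_le_iff₀ hγ, mul_comm _ P.α]
  exact h

/-- The optimality condition tested at u = x, with x - x⁺ = γ P_X and the strong monotonicity of ∇ω,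
after division by γ. -/
theorem le_inner_PX {γ : ℝ} (hγ : 0 < γ) {x : Vec n} (hx : x ∈ P.X) (g : Vec n) :
    P.α * γ * ‖P.PX x g γ‖ ^ 2 + (P.h (P.proj x g γ) - P.h x)
      ≤ γ * inner ℝ g (P.PX x g γ) := by
  have hp := (P.proj_spec hγ hx g).1
  have h1 := P.proj_optimality hγ hx g hx
  have h2 := P.strong_ω _ hx _ hp
  set p := P.proj x g γ with hpd
  have h3 : x - p = γ • P.PX x g γ := by
    simp [PX, smul_smul, hγ.ne', ← hpd]
  rw [real_inner_comm, h3, norm_smul, Real.norm_eq_abs, abs_of_pos hγ] at h2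
  rw [h3] at h1
  simp only [inner_add_left, inner_sub_left, real_inner_smul_left, real_inner_smul_right]
    at h1 h2
  have h4 : 0 ≤ γ * (γ * inner ℝ g (P.PX x g γ)
      - (P.α * γ * ‖P.PX x g γ‖ ^ 2 + (P.h p - P.h x))) := by nlinarith
  exact sub_nonneg.1 (nonneg_of_mul_nonneg_right h4 hγ)

theorem continuousOn_gradf : ContinuousOn P.gradf P.X := by
  refine (LipschitzOnWith.of_dist_le_mul (K := ⟨P.L, P.L_pos.le⟩) fun x hx y hy => ?_).continuousOn
  rw [dist_eq_norm, dist_eq_norm]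
  exact P.lipschitz_gradf y hy x hx

/-- The projection is defined by choice, so the measurability of the iterates has to come from
continuity. The Lipschitz bound in γg - ∇ω(x) reduces it to the continuity of ∇ω. -/
theorem continuousOn_proj {γ : ℝ} (hγ : 0 < γ) :
    ContinuousOn (fun q : Vec n × Vec n => P.proj q.1 q.2 γ) (P.X ×ˢ Set.univ) := by
  have hψ : ContinuousOn (fun q : Vec n × Vec n => γ • q.2 - P.gradω q.1)
      (P.X ×ˢ Set.univ) :=
    (continuous_snd.const_smul γ).continuousOn.sub
      (P.continuousOn_gradω.comp continuous_fst.continuousOn fun q hq => hq.1)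
  intro q hq
  have h1 := (hψ q hq).tendsto
  rw [tendsto_iff_norm_sub_tendsto_zero] at h1
  rw [ContinuousWithinAt, tendsto_iff_norm_sub_tendsto_zero]
  have h2 := h1.div_const P.α
  rw [zero_div] at h2
  refine squeeze_zero' (Filter.Eventually.of_forall fun _ => norm_nonneg _) ?_ h2
  filter_upwards [self_mem_nhdsWithin] with r hr
  rw [le_div_iff₀ P.α_pos, mul_comm]
  exact P.norm_proj_sub_proj_le hγ hr.1 hq.1 _ _

theorem step_pos (k : ℕ) : 0 < P.step k := div_pos P.α_pos (mul_pos two_pos P.L_pos)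

theorem gX_eq (x : Vec n) :
    P.gX x = (1 / (P.α / (2 * P.L))) • (x - P.proj x (P.gradf x) (P.α / (2 * P.L))) := by
  rw [gX, PX]

theorem continuousOn_gX : ContinuousOn P.gX P.X := by
  have hγ : 0 < P.α / (2 * P.L) := P.step_pos 0
  generalize hc : P.α / (2 * P.L) = γ at hγ
  have h1 : ContinuousOn (fun x => (x, P.gradf x)) P.X :=
    continuous_id.continuousOn.prodMk P.continuousOn_gradf
  have hm : Set.MapsTo (fun x => (x, P.gradf x)) P.X (P.X ×ˢ Set.univ) :=
    fun x hx => Set.mem_prod.2 ⟨hx, Set.mem_univ _⟩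
  have h : ContinuousOn (fun x => P.proj x (P.gradf x) γ) P.X := by
    simpa only [Function.comp_def] using (P.continuousOn_proj hγ).comp h1 hm
  have h2 : ContinuousOn (fun x => x - P.proj x (P.gradf x) γ) P.X :=
    continuous_id.continuousOn.sub h
  refine (h2.const_smul (1 / γ)).congr fun x _ => ?_
  rw [gX_eq, hc, Pi.smul_apply]

theorem PsiStar_le {x : Vec n} (hx : x ∈ P.X) : P.PsiStar ≤ P.Psi x :=
  csInf_le P.bddBelow ⟨x, hx, rfl⟩

theorem DPsi_sq {x : Vec n} (hx : x ∈ P.X) :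
    P.L * P.DPsi x ^ 2 = P.Psi x - P.PsiStar := by
  rw [DPsi, Real.sq_sqrt (div_nonneg (sub_nonneg.2 (P.PsiStar_le hx)) P.L_pos.le),
    mul_div_cancel₀ _ P.L_pos.ne']

/-- One step of the method, with the projected gradient at the exact gradient separated from
the error of the gradient estimate. -/
theorem Psi_proj_le {γ : ℝ} (hγ : 0 < γ) {x : Vec n} (hx : x ∈ P.X) (g : Vec n) :
    P.Psi (P.proj x g γ) + (P.α * γ - P.L * γ ^ 2 / 2) * ‖P.PX x g γ‖ ^ 2
      ≤ P.Psi x + γ * inner ℝ (g - P.gradf x) (P.PX x g γ) := by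
  have hp := (P.proj_spec hγ hx g).1
  have h1 := P.f_le hx hp
  have h2 := P.le_inner_PX hγ hx g
  have h3 : P.proj x g γ - x = -(γ • P.PX x g γ) := by
    simp [PX, smul_smul, hγ.ne']
  rw [h3, inner_neg_right, norm_neg, norm_smul, Real.norm_eq_abs, abs_of_pos hγ,
    real_inner_smul_right, mul_pow] at h1
  rw [inner_sub_left]
  simp only [Psi]
  nlinarith

end CompositeProblem

/-! ### Inequalities for the exponential and the smoothed norm -/

section Inequalities

/-- The linear term will have conditional mean zero, so only the exponential of the square remains,
which A2 controls. The ranges x ≤ 0, 0 ≤ x ≤ 4/3 and x ≥ 4/3 are treated apart; in the last one x ≤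
3x²/4 already suffices. -/
theorem Real.exp_le_add_exp_sq (x : ℝ) : Real.exp x ≤ x + Real.exp (3 / 4 * x ^ 2) := by
  rcases le_total x 0 with hx | hx
  · have h1 : Real.exp x ≤ 1 + x + x ^ 2 / 2 := by
      have h2 := Real.quadratic_le_exp_of_nonneg (neg_nonneg.2 hx)
      rw [Real.exp_neg] at h2
      have h3 : (1 + -x + (-x) ^ 2 / 2) * Real.exp x ≤ 1 := by
        have := mul_le_mul_of_nonneg_right h2 (Real.exp_pos x).le
        rwa [inv_mul_cancel₀ (Real.exp_pos x).ne'] at this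
      have h4 : 0 < 1 + -x + (-x) ^ 2 / 2 := by nlinarith
      have h5 : 1 ≤ (1 + -x + (-x) ^ 2 / 2) * (1 + x + x ^ 2 / 2) := by
        nlinarith [sq_nonneg (x ^ 2)]
      exact le_of_mul_le_mul_left (h3.trans h5) h4
    nlinarith [Real.add_one_le_exp (3 / 4 * x ^ 2), sq_nonneg x]
  rcases le_total (4 / 3) x with hx' | hx'
  · have : Real.exp x ≤ Real.exp (3 / 4 * x ^ 2) := Real.exp_le_exp.2 (by nlinarith)
    linarith
  -- Halving brings the argument into [0, 1], where the Taylor bound holds; squaring returns to x.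
  · obtain ⟨y, rfl⟩ : ∃ y, x = 2 * y := ⟨x / 2, by ring⟩
    have hy0 : 0 ≤ y := by linarith
    have hy1 : y ≤ 2 / 3 := by linarith
    have h1 : Real.exp y ≤ 1 + y + y ^ 2 / 2 + 2 / 9 * y ^ 3 := by
      have := Real.exp_bound' hy0 (by linarith) (n := 3) (by norm_num)
      norm_num [Finset.sum_range_succ, Nat.factorial] at this
      linarith
    have h2 : Real.exp (2 * y) ≤ (1 + y + y ^ 2 / 2 + 2 / 9 * y ^ 3) ^ 2 := by
      rw [two_mul, Real.exp_add, ← sq]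
      exact pow_le_pow_left₀ (Real.exp_pos y).le h1 2
    have h3 := Real.quadratic_le_exp_of_nonneg (x := 3 / 4 * (2 * y) ^ 2) (by positivity)
    have h4 : 0 ≤ 1 - 13 / 9 * y + 3 * y ^ 2 := by nlinarith [sq_nonneg (y - 1 / 4)]
    have h5 : 0 ≤ y ^ 2 * (1 - 13 / 9 * y + 3 * y ^ 2) := by positivity
    have h6 : y ^ 5 ≤ 2 / 3 * y ^ 4 := by
      have : 0 ≤ y ^ 4 * (2 / 3 - y) := mul_nonneg (by positivity) (by linarith)
      nlinarith
    have h7 : y ^ 6 ≤ 2 / 3 * y ^ 5 := by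
      have : 0 ≤ y ^ 5 * (2 / 3 - y) := mul_nonneg (by positivity) (by linarith)
      nlinarith
    have h8 : 0 ≤ y ^ 4 := by positivity
    nlinarith

/-- Convexity of exp between 0 and y - 1. With this anchor the right side has mean at most e^θ as
soon as e^y has mean at most e, so it takes the place of a conditional Jensen inequality. -/
theorem Real.exp_mul_le_affine {θ : ℝ} (h0 : 0 ≤ θ) (h1 : θ ≤ 1) (y : ℝ) :
    Real.exp (θ * y) ≤ Real.exp θ * (1 - θ) + Real.exp θ * θ * Real.exp (-1) * Real.exp y := by
  have h := convexOn_exp.2 (Set.mem_univ (y - 1)) (Set.mem_univ 0) h0 (sub_nonneg.2 h1) (by ring)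
  simp only [smul_eq_mul, mul_zero, add_zero, Real.exp_zero, mul_one] at h
  have e1 : Real.exp (θ * y) = Real.exp θ * Real.exp (θ * (y - 1)) := by
    rw [← Real.exp_add]; ring_nf
  have e2 : Real.exp (y - 1) = Real.exp (-1) * Real.exp y := by
    rw [← Real.exp_add]; ring_nf
  rw [e1]
  rw [e2] at h
  nlinarith [mul_le_mul_of_nonneg_left h (Real.exp_pos θ).le]

/-- A smooth majorant of the norm grows along a step by its linear part and a quadratic term. -/
theorem sqrt_norm_sq_add_le {E : Type*} [NormedAddCommGroup E] [InnerProductSpace ℝ E]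
    {β : ℝ} (hβ : 0 < β) (x d : E) :
    √(‖x + d‖ ^ 2 + β ^ 2) ≤ √(‖x‖ ^ 2 + β ^ 2)
      + inner ℝ ((1 / √(‖x‖ ^ 2 + β ^ 2)) • x) d + ‖d‖ ^ 2 / (2 * β) := by
  set φ := √(‖x‖ ^ 2 + β ^ 2) with hφ
  have hsq : φ ^ 2 = ‖x‖ ^ 2 + β ^ 2 := Real.sq_sqrt (by positivity)
  have hβφ : β ≤ φ := Real.le_sqrt_of_sq_le (by nlinarith [sq_nonneg ‖x‖])
  have hφ0 : 0 < φ := hβ.trans_le hβφ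
  -- What remains is √(φ² + u) ≤ φ + u/(2φ) with u = 2⟨x,d⟩ + ‖d‖²; only the quadratic part has its
  -- denominator weakened to 2β.
  have h1 : ‖d‖ ^ 2 / (2 * φ) ≤ ‖d‖ ^ 2 / (2 * β) := by gcongr
  refine le_trans ?_ (add_le_add_right h1 _)
  rw [real_inner_smul_left, norm_add_sq_real]
  have e : φ + 1 / φ * inner ℝ x d + ‖d‖ ^ 2 / (2 * φ)
      = (2 * φ ^ 2 + (2 * inner ℝ x d + ‖d‖ ^ 2)) / (2 * φ) := by
    field_simp
    ring
  have h2 : 0 ≤ φ ^ 2 + (2 * inner ℝ x d + ‖d‖ ^ 2) := by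
    have := norm_add_sq_real x d
    nlinarith [sq_nonneg ‖x + d‖, sq_nonneg β]
  rw [e]
  refine Real.sqrt_le_iff.2 ⟨div_nonneg (by nlinarith [sq_nonneg φ]) (by positivity), ?_⟩
  rw [div_pow, le_div_iff₀ (by positivity)]
  nlinarith [sq_nonneg (2 * inner ℝ x d + ‖d‖ ^ 2)]

end Inequalities

/-! ### Conditional expectations and products of conditionally bounded factors -/

section Conditional

variable {n : ℕ} {Ω : Type*} {mΩ : MeasurableSpace Ω} {μ : Measure Ω}

theorem condExp_inner_eq_zero {m : MeasurableSpace Ω} {Y δ : Ω → Vec n}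
    (hY : Measurable[m] Y) (hδ : Integrable δ μ) (h0 : μ[δ | m] =ᵐ[μ] 0)
    (hYδ : Integrable (fun ω => inner ℝ (Y ω) (δ ω)) μ) :
    μ[fun ω => inner ℝ (Y ω) (δ ω) | m] =ᵐ[μ] 0 := by
  have hYs : AEStronglyMeasurable[m] Y μ := hY.stronglyMeasurable.aestronglyMeasurable
  have h := condExp_bilin_of_aestronglyMeasurable_left (innerSL ℝ (E := Vec n)) hYs hYδ hδ
  refine h.trans ?_
  filter_upwards [h0] with ω hω
  simp [hω]

theorem integral_inner_eq_zero [IsProbabilityMeasure μ] {m : MeasurableSpace Ω} (hm : m ≤ mΩ) {Y δ : Ω → Vec n}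
    (hY : Measurable[m] Y) (hδ : Integrable δ μ) (h0 : μ[δ | m] =ᵐ[μ] 0)
    (hYδ : Integrable (fun ω => inner ℝ (Y ω) (δ ω)) μ) :
    ∫ ω, inner ℝ (Y ω) (δ ω) ∂μ = 0 := by
  rw [← integral_condExp hm, integral_congr_ae (condExp_inner_eq_zero hY hδ h0 hYδ)]
  simp

/-- A bound on a conditional expectation may be used under a nonnegative factor that is
measurable with respect to the conditioning. -/
theorem lintegral_mul_ofReal_le [IsProbabilityMeasure μ] {m : MeasurableSpace Ω} (hm : m ≤ mΩ) {W : Ω → ENNReal}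
    (hW : Measurable[m] W) {Z : Ω → ℝ} (hZ0 : ∀ ω, 0 ≤ Z ω) (hZ : Integrable Z μ)
    {C : ℝ} (hC : ∀ᵐ ω ∂μ, (μ[Z | m]) ω ≤ C) :
    ∫⁻ ω, W ω * ENNReal.ofReal (Z ω) ∂μ ≤ ENNReal.ofReal C * ∫⁻ ω, W ω ∂μ := by
  -- The conditional bound becomes an inequality between measures on the smaller σ-algebra, so W
  -- needs no integrability.
  have hle : (μ.withDensity fun ω => ENNReal.ofReal (Z ω)).trim hm
      ≤ ENNReal.ofReal C • μ.trim hm := by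
    refine @Measure.le_intro _ m _ _ fun s hs _ => ?_
    rw [trim_measurableSet_eq hm hs, Measure.smul_apply, trim_measurableSet_eq hm hs,
      withDensity_apply _ (hm s hs),
      ← ofReal_integral_eq_lintegral_ofReal hZ.integrableOn (Filter.Eventually.of_forall hZ0),
      ← setIntegral_condExp hm hZ hs, smul_eq_mul]
    have h1 : ∫ ω in s, (μ[Z | m]) ω ∂μ ≤ ∫ _ in s, C ∂μ :=
      setIntegral_mono_ae integrable_condExp.integrableOn (integrable_const C).integrableOn hC
    refine (ENNReal.ofReal_le_ofReal h1).trans ?_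
    rw [setIntegral_const, smul_eq_mul, mul_comm]
    rcases le_total 0 C with h | h
    · rw [ENNReal.ofReal_mul h, ofReal_measureReal]
    · rw [ENNReal.ofReal_of_nonpos (mul_nonpos_of_nonpos_of_nonneg h measureReal_nonneg)]
      exact zero_le
  have hmeas : AEMeasurable (fun ω => ENNReal.ofReal (Z ω)) μ :=
    hZ.aestronglyMeasurable.aemeasurable.ennreal_ofReal
  calc ∫⁻ ω, W ω * ENNReal.ofReal (Z ω) ∂μ
      = ∫⁻ ω, W ω ∂(μ.withDensity fun ω => ENNReal.ofReal (Z ω)) := by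
        rw [lintegral_withDensity_eq_lintegral_mul₀ hmeas (hW.mono hm le_rfl).aemeasurable]
        exact lintegral_congr fun ω => mul_comm _ _
    _ = ∫⁻ ω, W ω ∂((μ.withDensity fun ω => ENNReal.ofReal (Z ω)).trim hm) :=
        (lintegral_trim hm hW).symm
    _ ≤ ∫⁻ ω, W ω ∂(ENNReal.ofReal C • μ.trim hm) := lintegral_mono' hle le_rfl
    _ = ENNReal.ofReal C * ∫⁻ ω, W ω ∂μ := by
        rw [lintegral_smul_measure, lintegral_trim hm hW, smul_eq_mul]

/-- A product of nonnegative variables with conditional expectations at most `C`. -/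
theorem lintegral_prod_ofReal_le [IsProbabilityMeasure μ] {T : ℕ} {m : ℕ → MeasurableSpace Ω} (hm : ∀ t, m t ≤ mΩ)
    {Z : ℕ → Ω → ℝ} (hZm : ∀ t u, 1 ≤ u → u < t → t ≤ T → Measurable[m t] (Z u))
    (hZ0 : ∀ t ω, 0 ≤ Z t ω) {C : ℝ}
    (hZ : ∀ t ∈ Finset.Icc 1 T, Integrable (Z t) μ ∧ ∀ᵐ ω ∂μ, (μ[Z t | m t]) ω ≤ C) :
    ∫⁻ ω, ∏ t ∈ Finset.Icc 1 T, ENNReal.ofReal (Z t ω) ∂μ ≤ ENNReal.ofReal C ^ T := by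
  suffices h : ∀ k ≤ T, ∫⁻ ω, ∏ t ∈ Finset.Icc 1 k, ENNReal.ofReal (Z t ω) ∂μ
      ≤ ENNReal.ofReal C ^ k from h T le_rfl
  intro k
  induction k with
  | zero => simp
  | succ k ih =>
    intro hk
    simp only [Finset.prod_Icc_succ_top (Nat.le_add_left 1 k)]
    obtain ⟨h1, h2⟩ := hZ (k + 1) (Finset.mem_Icc.2 ⟨by lia, hk⟩)
    refine (lintegral_mul_ofReal_le (hm (k + 1)) ?_ (hZ0 _) h1 h2).trans ?_
    · refine Finset.measurable_prod _ fun u hu => ?_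
      rw [Finset.mem_Icc] at hu
      exact (hZm _ u hu.1 (by lia) hk).ennreal_ofReal
    · rw [pow_succ, mul_comm]
      exact mul_le_mul_left (ih (by lia)) _

/-- Taking conditional expectations in `Real.exp_mul_le_affine` gives e^θ(1 - θ) + e^θ θ e⁻¹ e =
e^θ. -/
theorem condExp_exp_mul_le [IsProbabilityMeasure μ] {m : MeasurableSpace Ω}
    (hm : m ≤ mΩ) {Y : Ω → ℝ}
    (hY0 : ∀ ω, 0 ≤ Y ω) (hY : Integrable (fun ω => Real.exp (Y ω)) μ)
    (hC : ∀ᵐ ω ∂μ, (μ[fun ω => Real.exp (Y ω) | m]) ω ≤ Real.exp 1) {θ : ℝ} (h0 : 0 ≤ θ)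
    (h1 : θ ≤ 1) (hYm : Measurable[mΩ] Y) :
    Integrable (fun ω => Real.exp (θ * Y ω)) μ ∧
      ∀ᵐ ω ∂μ, (μ[fun ω => Real.exp (θ * Y ω) | m]) ω ≤ Real.exp θ := by
  have hint : Integrable (fun ω => Real.exp (θ * Y ω)) μ := by
    refine hY.mono' (hYm.const_mul θ).exp.aestronglyMeasurable
      (Filter.Eventually.of_forall fun ω => ?_)
    rw [Real.norm_eq_abs, Real.abs_exp, Real.exp_le_exp]
    nlinarith [hY0 ω]
  refine ⟨hint, ?_⟩
  set a := Real.exp θ * (1 - θ)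
  set b := Real.exp θ * θ * Real.exp (-1) with hb
  have hmono : μ[fun ω => Real.exp (θ * Y ω) | m]
      ≤ᵐ[μ] μ[(fun _ => a) + b • (fun ω => Real.exp (Y ω)) | m] :=
    condExp_mono hint ((integrable_const a).add (hY.smul b))
      (Filter.Eventually.of_forall fun ω => Real.exp_mul_le_affine h0 h1 (Y ω))
  have hadd := condExp_add (m := m) (integrable_const (μ := μ) a) (hY.smul b)
  have hsm := condExp_smul (μ := μ) b (fun ω => Real.exp (Y ω)) m
  filter_upwards [hmono, hadd, hsm, hC] with ω e1 e2 e3 e4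
  rw [e2, Pi.add_apply, condExp_const hm, e3, Pi.smul_apply, smul_eq_mul] at e1
  have hb0 : 0 ≤ b := by positivity
  have h5 := mul_le_mul_of_nonneg_left e4 hb0
  have h6 : b * Real.exp 1 = Real.exp θ * θ := by
    rw [hb, mul_assoc, ← Real.exp_add]; simp
  rw [h6] at h5
  linarith

end Conditional

/-! ### Tail and variance bounds for vector martingale differences -/

section Martingale

variable {n : ℕ} {Ω : Type*} {m mΩ : MeasurableSpace Ω} {μ : Measure Ω}

theorem CallA2.condExp_exp_mul_le [IsProbabilityMeasure μ] (hm : m ≤ mΩ) {σ : ℝ}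
    {δ : Ω → Vec n} (h : CallA2 μ m σ δ) (hδ : Measurable[mΩ] δ) {θ : ℝ} (h0 : 0 ≤ θ)
    (h1 : θ ≤ 1) :
    Integrable (fun ω => Real.exp (θ * (‖δ ω‖ ^ 2 / σ ^ 2))) μ ∧
      ∀ᵐ ω ∂μ, (μ[fun ω => Real.exp (θ * (‖δ ω‖ ^ 2 / σ ^ 2)) | m]) ω ≤ Real.exp θ :=
  _root_.condExp_exp_mul_le hm (fun ω => by positivity) h.1 h.2 h0 h1
    ((hδ.norm.pow_const 2).div_const _)

/-- The components of the error of an oracle call are conditionally subgaussian. -/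
theorem condExp_exp_inner_le [IsProbabilityMeasure μ] (hm : m ≤ mΩ) {σ : ℝ} (hσ : 0 < σ)
    {δ : Ω → Vec n} (hA1 : CallA1 μ m σ δ) (hA2 : CallA2 μ m σ δ) (hδ : Measurable[mΩ] δ)
    {e : Ω → Vec n} (he : Measurable[m] e) (he1 : ∀ ω, ‖e ω‖ ≤ 1) {c : ℝ}
    (hc : 3 / 4 * c ^ 2 ≤ 1) :
    Integrable (fun ω => Real.exp (c * inner ℝ (e ω) (σ⁻¹ • δ ω))) μ ∧
      ∀ᵐ ω ∂μ, (μ[fun ω => Real.exp (c * inner ℝ (e ω) (σ⁻¹ • δ ω)) | m]) ω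
        ≤ Real.exp (3 / 4 * c ^ 2) := by
  set x : Ω → ℝ := fun ω => c * inner ℝ (e ω) (σ⁻¹ • δ ω) with hx
  have he' : Measurable[mΩ] e := he.mono hm le_rfl
  have hxm : Measurable[mΩ] x := (he'.inner (hδ.const_smul σ⁻¹)).const_mul c
  have habs : ∀ ω, |inner ℝ (e ω) (σ⁻¹ • δ ω)| ≤ ‖δ ω‖ / σ := fun ω => by
    refine (abs_real_inner_le_norm _ _).trans ?_
    rw [norm_smul, norm_inv, Real.norm_eq_abs, abs_of_pos hσ, inv_mul_eq_div]
    exact mul_le_of_le_one_left (by positivity) (he1 ω)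
  have hint0 : Integrable (fun ω => inner ℝ (e ω) (σ⁻¹ • δ ω)) μ :=
    (hA1.1.1.norm.div_const σ).mono' (he'.inner (hδ.const_smul σ⁻¹)).aestronglyMeasurable
      (Filter.Eventually.of_forall habs)
  have hxint : Integrable x μ := hint0.const_mul c
  obtain ⟨hEint, hE⟩ := hA2.condExp_exp_mul_le hm hδ (by positivity) hc
  -- The square of the component is at most c²‖δ‖²/σ², so A2 applies with exponent 3c²/4, which is
  -- at most 1.
  have hle : ∀ ω, Real.exp (x ω) ≤ x ω + Real.exp (3 / 4 * c ^ 2 * (‖δ ω‖ ^ 2 / σ ^ 2)) := by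
    intro ω
    refine (Real.exp_le_add_exp_sq (x ω)).trans (add_le_add_right (Real.exp_le_exp.2 ?_) _)
    have h1 : inner ℝ (e ω) (σ⁻¹ • δ ω) ^ 2 ≤ ‖δ ω‖ ^ 2 / σ ^ 2 := by
      rw [← div_pow, ← sq_abs]
      exact pow_le_pow_left₀ (abs_nonneg _) (habs ω) 2
    have h2 : 0 ≤ 3 / 4 * c ^ 2 := by positivity
    simp only [hx, mul_pow]
    nlinarith [mul_le_mul_of_nonneg_left h1 h2]
  have hint : Integrable (fun ω => Real.exp (x ω)) μ :=
    (hxint.add hEint).mono' hxm.exp.aestronglyMeasurable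
      (Filter.Eventually.of_forall fun ω => by
        rw [Real.norm_eq_abs, Real.abs_exp]; exact hle ω)
  refine ⟨hint, ?_⟩
  -- The direction e is known given the history, so it comes out of the conditional expectation and
  -- A1 applies.
  have hzero : μ[x | m] =ᵐ[μ] 0 := by
    have hxe : x = fun ω => inner ℝ ((c * σ⁻¹) • e ω) (δ ω) := by
      funext ω
      simp only [hx, real_inner_smul_left, real_inner_smul_right, mul_assoc]
    have hxint' := hxint
    rw [hxe] at hxint' ⊢
    exact condExp_inner_eq_zero (Measurable.const_smul he (c * σ⁻¹)) hA1.1.1 hA1.1.2 hxint'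
  have hmono : μ[fun ω => Real.exp (x ω) | m]
      ≤ᵐ[μ] μ[x + (fun ω => Real.exp (3 / 4 * c ^ 2 * (‖δ ω‖ ^ 2 / σ ^ 2))) | m] :=
    condExp_mono hint (hxint.add hEint) (Filter.Eventually.of_forall hle)
  filter_upwards [hmono, condExp_add hxint hEint m, hzero, hE] with ω e1 e2 e3 e4
  rw [e2, Pi.add_apply, e3, Pi.zero_apply, zero_add] at e1
  exact e1.trans e4

theorem measureReal_le_of_lintegral {E : Set Ω} {F : Ω → ENNReal} (hF : Measurable F)
    (h1 : ∀ ω ∈ E, 1 ≤ F ω) {r : ℝ} (hr : 0 ≤ r) (h2 : ∫⁻ ω, F ω ∂μ ≤ ENNReal.ofReal r) :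
    μ.real E ≤ r := by
  refine ENNReal.toReal_le_of_le_ofReal hr (le_trans ?_ h2)
  have := mul_meas_ge_le_lintegral (μ := μ) hF 1
  rw [one_mul] at this
  exact (measure_mono h1).trans this

/-- A deviation bound for sums of vector-valued martingale differences. -/
theorem measureReal_norm_sum_sq_ge_le [IsProbabilityMeasure μ] {T : ℕ} (hT : 1 ≤ T) {σ : ℝ} (hσ : 0 < σ)
    {m : ℕ → MeasurableSpace Ω} (hm : ∀ t, m t ≤ mΩ) {δ : ℕ → Ω → Vec n}
    (hδ : ∀ t, Measurable[mΩ] (δ t))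
    (hδm : ∀ t u, 1 ≤ u → u < t → t ≤ T → Measurable[m t] (δ u))
    (hA1 : ∀ t ∈ Finset.Icc 1 T, CallA1 μ (m t) σ (δ t))
    (hA2 : ∀ t ∈ Finset.Icc 1 T, CallA2 μ (m t) σ (δ t)) {lam : ℝ} (hlam : 0 < lam) :
    μ.real {ω | 2 * (1 + lam) ^ 2 * σ ^ 2 * T ≤ ‖∑ t ∈ Finset.Icc 1 T, δ t ω‖ ^ 2}
      ≤ Real.exp (-lam ^ 2 / 3) := by
  have hT0 : (0 : ℝ) < T := by exact_mod_cast hT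
  have hYgen : ∀ (m' : MeasurableSpace Ω) (u : ℕ), Measurable[m'] (δ u) → ∀ θ : ℝ,
      Measurable[m'] fun ω => Real.exp (θ * (‖δ u ω‖ ^ 2 / σ ^ 2)) :=
    fun m' u h θ => (((h.norm.pow_const 2).div_const (σ ^ 2)).const_mul θ).exp
  have hexpY : ∀ θ : ℝ, 0 ≤ θ → θ ≤ 1 →
      ∫⁻ ω, ENNReal.ofReal (Real.exp (θ * ∑ t ∈ Finset.Icc 1 T, ‖δ t ω‖ ^ 2 / σ ^ 2)) ∂μ
        ≤ ENNReal.ofReal (Real.exp (θ * T)) := by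
    intro θ h0 h1
    have h := lintegral_prod_ofReal_le (μ := μ) (T := T) hm
      (Z := fun t ω => Real.exp (θ * (‖δ t ω‖ ^ 2 / σ ^ 2))) (C := Real.exp θ)
      (fun t u hu hut ht => by
        exact hYgen (m t) u (hδm t u hu hut ht) θ)
      (fun t ω => (Real.exp_pos _).le)
      (fun t ht => (hA2 t ht).condExp_exp_mul_le (hm t) (hδ t) h0 h1)
    rw [← ENNReal.ofReal_pow (Real.exp_pos _).le, ← Real.exp_nat_mul, mul_comm] at h
    refine le_trans (le_of_eq (lintegral_congr fun ω => ?_)) h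
    rw [Finset.mul_sum, Real.exp_sum, ENNReal.ofReal_prod_of_nonneg]
    exact fun _ _ => (Real.exp_pos _).le
  -- For large λ the crude bound ‖∑δ‖² ≤ T∑‖δ‖² suffices. Otherwise 2λ²/(3T) ≤ 1, which is what the
  -- subgaussian estimate requires.
  rcases lt_or_ge (3 / 2 * (T : ℝ)) (lam ^ 2) with hcase | hcase
  · refine measureReal_le_of_lintegral
      (F := fun ω => ENNReal.ofReal (Real.exp (-(2 * (1 + lam) ^ 2)))
        * ENNReal.ofReal (Real.exp (1 * ∑ t ∈ Finset.Icc 1 T, ‖δ t ω‖ ^ 2 / σ ^ 2)))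
      ?_ ?_ (Real.exp_pos _).le ?_
    · refine Measurable.const_mul ?_ _
      refine ((Finset.measurable_sum _ fun t _ => ?_).const_mul 1).exp.ennreal_ofReal
      exact ((hδ t).norm.pow_const 2).div_const _
    · intro ω hω
      rw [← ENNReal.ofReal_mul (Real.exp_pos _).le, ← Real.exp_add, ENNReal.one_le_ofReal,
        Real.one_le_exp_iff, ← Finset.sum_div]
      have h1 : ‖∑ t ∈ Finset.Icc 1 T, δ t ω‖ ^ 2
          ≤ T * ∑ t ∈ Finset.Icc 1 T, ‖δ t ω‖ ^ 2 := by
        refine (pow_le_pow_left₀ (norm_nonneg _) (norm_sum_le _ _) 2).trans ?_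
        simpa using sq_sum_le_card_mul_sum_sq (s := Finset.Icc 1 T) (f := fun t => ‖δ t ω‖)
      have h2 : 2 * (1 + lam) ^ 2 ≤ (∑ t ∈ Finset.Icc 1 T, ‖δ t ω‖ ^ 2) / σ ^ 2 := by
        rw [le_div_iff₀ (by positivity)]
        refine le_of_mul_le_mul_right ?_ hT0
        exact (Set.mem_ofPred.1 hω).trans (h1.trans_eq (mul_comm _ _))
      linarith
    · rw [lintegral_const_mul' _ _ ENNReal.ofReal_ne_top]
      refine (mul_le_mul_right (hexpY 1 zero_le_one le_rfl) _).trans ?_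
      rw [← ENNReal.ofReal_mul (Real.exp_pos _).le, ← Real.exp_add]
      refine ENNReal.ofReal_le_ofReal (Real.exp_le_exp.2 ?_)
      nlinarith
  -- With T = 2β² the quadratic remainder has mean at most T/(2β) = β, equal to the initial value β
  -- of φ. Together they make up 2β, leaving 2βλ for the deviations.
  · set β := √((T : ℝ) / 2) with hβd
    have hβ : 0 < β := Real.sqrt_pos.2 (by positivity)
    have hβsq : β ^ 2 = T / 2 := Real.sq_sqrt (by positivity)
    let S : ℕ → Ω → Vec n := fun t ω => ∑ u ∈ Finset.Icc 1 t, σ⁻¹ • δ u ω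
    let φ : ℕ → Ω → ℝ := fun t ω => √(‖S t ω‖ ^ 2 + β ^ 2)
    -- The gradient of the smoothed norm at the previous partial sum: it is predictable and has norm
    -- at most 1.
    let e : ℕ → Ω → Vec n := fun t ω => (1 / φ (t - 1) ω) • S (t - 1) ω
    let X : ℕ → Ω → ℝ := fun t ω => inner ℝ (e t ω) (σ⁻¹ • δ t ω)
    let Y : ℕ → Ω → ℝ := fun t ω => ‖δ t ω‖ ^ 2 / σ ^ 2
    have he1 : ∀ t ω, ‖e t ω‖ ≤ 1 := by
      intro t ω
      have h0 : 0 < φ (t - 1) ω := Real.sqrt_pos.2 (by positivity)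
      have h1 : ‖S (t - 1) ω‖ ≤ φ (t - 1) ω := Real.le_sqrt_of_sq_le (by nlinarith)
      rw [norm_smul, norm_div, norm_one, Real.norm_eq_abs, abs_of_pos h0, one_div_mul_eq_div]
      exact (div_le_one h0).2 h1
    have hSgen : ∀ (m' : MeasurableSpace Ω) (t : ℕ),
        (∀ u, 1 ≤ u → u ≤ t → Measurable[m'] (δ u)) → Measurable[m'] (S t) := by
      intro m' t h
      refine Finset.measurable_sum _ fun u hu => ?_
      rw [Finset.mem_Icc] at hu
      have := h u hu.1 hu.2
      exact Measurable.const_smul this σ⁻¹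
    have hegen : ∀ (m' : MeasurableSpace Ω) (t : ℕ),
        (∀ u, 1 ≤ u → u ≤ t - 1 → Measurable[m'] (δ u)) → Measurable[m'] (e t) := by
      intro m' t h
      have h1 := hSgen m' (t - 1) h
      have h2 : Measurable[m'] fun ω => ‖S (t - 1) ω‖ := h1.norm
      exact Measurable.smul (((h2.pow_const 2).add_const (β ^ 2)).sqrt.const_div 1) h1
    have hXgen : ∀ (m' : MeasurableSpace Ω) (t : ℕ), 1 ≤ t →
        (∀ u, 1 ≤ u → u ≤ t → Measurable[m'] (δ u)) → ∀ c : ℝ,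
        Measurable[m'] fun ω => Real.exp (c * X t ω) := by
      intro m' t ht h c
      have h1 := hegen m' t fun u hu hut => h u hu (by lia)
      exact ((h1.inner (Measurable.const_smul (h t ht le_rfl) σ⁻¹)).const_mul c).exp
    have hpath : ∀ ω k, φ k ω ≤ β + ∑ t ∈ Finset.Icc 1 k, X t ω
        + (∑ t ∈ Finset.Icc 1 k, Y t ω) / (2 * β) := by
      intro ω k
      induction k with
      | zero => simp [φ, S, Real.sqrt_sq hβ.le]
      | succ k ih =>
        have h := sqrt_norm_sq_add_le hβ (S k ω) (σ⁻¹ • δ (k + 1) ω)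
        have hS : S (k + 1) ω = S k ω + σ⁻¹ • δ (k + 1) ω :=
          Finset.sum_Icc_succ_top (Nat.le_add_left 1 k) _
        rw [← hS, norm_smul, mul_pow, norm_inv, Real.norm_eq_abs, abs_of_pos hσ, inv_pow,
          inv_mul_eq_div] at h
        rw [Finset.sum_Icc_succ_top (Nat.le_add_left 1 k),
          Finset.sum_Icc_succ_top (Nat.le_add_left 1 k), add_div]
        have h' : φ (k + 1) ω ≤ φ k ω + X (k + 1) ω + Y (k + 1) ω / (2 * β) := h
        linarith
    have hc : 3 / 4 * (2 * lam / (3 * β)) ^ 2 = 2 * lam ^ 2 / (3 * T) := by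
      rw [div_pow, mul_pow, mul_pow, hβsq]
      field_simp
      ring
    have hc1 : 2 * lam ^ 2 / (3 * T) ≤ 1 := (div_le_one (by positivity)).2 (by linarith)
    have hT1 : (1 : ℝ) ≤ T := by exact_mod_cast hT
    have hθ : 2 * lam / (3 * T) ≤ 1 := (div_le_one (by positivity)).2 (by nlinarith)
    have hexpX : ∫⁻ ω, ENNReal.ofReal
        (Real.exp (2 * lam / (3 * β) * ∑ t ∈ Finset.Icc 1 T, X t ω)) ∂μ
          ≤ ENNReal.ofReal (Real.exp (2 * lam ^ 2 / 3)) := by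
      have h := lintegral_prod_ofReal_le (μ := μ) (T := T) hm
        (Z := fun t ω => Real.exp (2 * lam / (3 * β) * X t ω))
        (C := Real.exp (3 / 4 * (2 * lam / (3 * β)) ^ 2))
        (fun t u hu hut ht => by
          exact hXgen (m t) u hu (fun v hv hvu => hδm t v hv (by lia) ht) _)
        (fun t ω => (Real.exp_pos _).le)
        (fun t ht => condExp_exp_inner_le (hm t) hσ (hA1 t ht) (hA2 t ht) (hδ t)
          (hegen (m t) t fun v hv hvt => by
            rw [Finset.mem_Icc] at ht
            exact hδm t v hv (by lia) ht.2) (he1 t) (hc.trans_le hc1))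
      rw [← ENNReal.ofReal_pow (Real.exp_pos _).le, ← Real.exp_nat_mul, hc,
        show (T : ℝ) * (2 * lam ^ 2 / (3 * T)) = 2 * lam ^ 2 / 3 by field_simp] at h
      refine le_trans (le_of_eq (lintegral_congr fun ω => ?_)) h
      rw [Finset.mul_sum, Real.exp_sum, ENNReal.ofReal_prod_of_nonneg]
      exact fun _ _ => (Real.exp_pos _).le
    have hexpY' := hexpY (2 * lam / (3 * T)) (by positivity) hθ
    rw [show 2 * lam / (3 * T) * (T : ℝ) = 2 * lam / 3 by field_simp] at hexpY'
    have hXm : Measurable fun ω => ENNReal.ofReal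
        (Real.exp (2 * lam / (3 * β) * ∑ t ∈ Finset.Icc 1 T, X t ω)) := by
      refine ((Finset.measurable_sum _ fun t _ => ?_).const_mul _).exp.ennreal_ofReal
      exact (hegen mΩ t fun v _ _ => hδ v).inner ((hδ t).const_smul σ⁻¹)
    have hYm : Measurable fun ω => ENNReal.ofReal
        (Real.exp (2 * lam / (3 * T) * ∑ t ∈ Finset.Icc 1 T, Y t ω)) := by
      refine ((Finset.measurable_sum _ fun t _ => ?_).const_mul _).exp.ennreal_ofReal
      exact ((hδ t).norm.pow_const 2).div_const _
    have hhalf : ∀ a b : ℝ, Real.exp a / 2 * Real.exp b = Real.exp (a + b) / 2 := fun a b => by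
      rw [Real.exp_add]; ring
    -- Each shift makes the corresponding exponential moment at most exp(-λ²/3). On the event the
    -- two shifted exponents have a nonnegative sum, so the mean of their exponentials is at least
    -- 1; no independence of the two sums is needed.
    set a₁ := -lam ^ 2 / 3 - 2 * lam ^ 2 / 3 with ha₁
    set a₂ := -lam ^ 2 / 3 - 2 * lam / 3 with ha₂
    refine measureReal_le_of_lintegral
      (F := fun ω => ENNReal.ofReal (Real.exp a₁ / 2) * ENNReal.ofReal
          (Real.exp (2 * lam / (3 * β) * ∑ t ∈ Finset.Icc 1 T, X t ω))
        + ENNReal.ofReal (Real.exp a₂ / 2) * ENNReal.ofReal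
          (Real.exp (2 * lam / (3 * T) * ∑ t ∈ Finset.Icc 1 T, Y t ω)))
      ((hXm.const_mul _).add (hYm.const_mul _)) ?_ (Real.exp_pos _).le ?_
    · intro ω hω
      have hω' : 2 * (1 + lam) ^ 2 * σ ^ 2 * T ≤ ‖∑ t ∈ Finset.Icc 1 T, δ t ω‖ ^ 2 := hω
      have h1 : ‖∑ t ∈ Finset.Icc 1 T, δ t ω‖ ^ 2 = σ ^ 2 * ‖S T ω‖ ^ 2 := by
        have : S T ω = σ⁻¹ • ∑ t ∈ Finset.Icc 1 T, δ t ω := Finset.smul_sum.symm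
        rw [this, norm_smul, mul_pow, norm_inv, Real.norm_eq_abs, abs_of_pos hσ]
        field_simp
      have h2 : (2 * β * (1 + lam)) ^ 2 ≤ ‖S T ω‖ ^ 2 := by
        rw [h1] at hω'
        have h3 : σ ^ 2 * (2 * β * (1 + lam)) ^ 2 ≤ σ ^ 2 * ‖S T ω‖ ^ 2 := by
          refine le_trans (le_of_eq ?_) hω'
          rw [mul_pow, mul_pow, hβsq]
          ring
        exact le_of_mul_le_mul_left h3 (by positivity)
      have h3 : 2 * β * (1 + lam) ≤ φ T ω :=
        Real.le_sqrt_of_sq_le (by nlinarith)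
      have h4 := h3.trans (hpath ω T)
      set sX := ∑ t ∈ Finset.Icc 1 T, X t ω
      set sY := ∑ t ∈ Finset.Icc 1 T, Y t ω
      have h5 : 0 ≤ (a₁ + 2 * lam / (3 * β) * sX) + (a₂ + 2 * lam / (3 * T) * sY) := by
        have h6 : 2 * lam / (3 * β) * (β + 2 * β * lam)
            ≤ 2 * lam / (3 * β) * (sX + sY / (2 * β)) :=
          mul_le_mul_of_nonneg_left (by linarith) (by positivity)
        have h7 : 2 * lam / (3 * β) * (β + 2 * β * lam) = 2 * lam / 3 + 4 * lam ^ 2 / 3 := by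
          field_simp
          ring
        have h8 : 2 * lam / (3 * β) * (sX + sY / (2 * β))
            = 2 * lam / (3 * β) * sX + 2 * lam / (3 * T) * sY := by
          have : (T : ℝ) = 2 * β ^ 2 := by rw [hβsq]; ring
          rw [this]
          field_simp
        rw [h7, h8] at h6
        rw [ha₁, ha₂]
        linarith
      rw [← ENNReal.ofReal_mul (by positivity), ← ENNReal.ofReal_mul (by positivity),
        ← ENNReal.ofReal_add (by positivity) (by positivity), ENNReal.one_le_ofReal,
        hhalf, hhalf]
      have h9 := Real.add_one_le_exp (a₁ + 2 * lam / (3 * β) * sX)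
      have h10 := Real.add_one_le_exp (a₂ + 2 * lam / (3 * T) * sY)
      linarith
    · rw [lintegral_add_left (hXm.const_mul _), lintegral_const_mul' _ _ ENNReal.ofReal_ne_top,
        lintegral_const_mul' _ _ ENNReal.ofReal_ne_top]
      refine (add_le_add (mul_le_mul_right hexpX _) (mul_le_mul_right hexpY' _)).trans ?_
      rw [← ENNReal.ofReal_mul (by positivity), ← ENNReal.ofReal_mul (by positivity),
        ← ENNReal.ofReal_add (by positivity) (by positivity)]
      refine ENNReal.ofReal_le_ofReal (le_of_eq ?_)
      rw [hhalf, hhalf, ha₁, ha₂, sub_add_cancel, sub_add_cancel, add_halves]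

theorem CallA1.memLp {σ : ℝ} {δ : Ω → Vec n} (h : CallA1 μ m σ δ) :
    MemLp δ 2 μ :=
  (memLp_two_iff_integrable_sq_norm h.1.1.aestronglyMeasurable).2 h.2.1

theorem MemLp.integrable_inner_real {f g : Ω → Vec n} (hf : MemLp f 2 μ) (hg : MemLp g 2 μ) :
    Integrable (fun ω => inner ℝ (f ω) (g ω)) μ := by
  have h1 := (memLp_two_iff_integrable_sq_norm hf.1).1 hf
  have h2 := (memLp_two_iff_integrable_sq_norm hg.1).1 hg
  refine (h1.add h2).mono' (hf.1.inner hg.1) (Filter.Eventually.of_forall fun ω => ?_)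
  rw [Real.norm_eq_abs, Pi.add_apply]
  have := abs_real_inner_le_norm (f ω) (g ω)
  nlinarith [sq_nonneg (‖f ω‖ - ‖g ω‖), sq_nonneg (‖f ω‖ + ‖g ω‖)]

/-- Martingale differences are orthogonal. -/
theorem integral_norm_sum_sq_le [IsProbabilityMeasure μ] {T : ℕ} {σ : ℝ} {m : ℕ → MeasurableSpace Ω}
    (hm : ∀ t, m t ≤ mΩ) {δ : ℕ → Ω → Vec n}
    (hδm : ∀ t u, 1 ≤ u → u < t → t ≤ T → Measurable[m t] (δ u))
    (hA1 : ∀ t ∈ Finset.Icc 1 T, CallA1 μ (m t) σ (δ t)) :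
    ∫ ω, ‖∑ t ∈ Finset.Icc 1 T, δ t ω‖ ^ 2 ∂μ ≤ T * σ ^ 2 := by
  suffices h : ∀ k ≤ T, ∫ ω, ‖∑ t ∈ Finset.Icc 1 k, δ t ω‖ ^ 2 ∂μ ≤ k * σ ^ 2 from h T le_rfl
  intro k
  induction k with
  | zero => simp
  | succ k ih =>
    intro hk
    have hA := hA1 (k + 1) (Finset.mem_Icc.2 ⟨by lia, hk⟩)
    have hS2 : MemLp (fun ω => ∑ t ∈ Finset.Icc 1 k, δ t ω) 2 μ :=
      memLp_finsetSum _ fun t ht => (hA1 t (Finset.Icc_subset_Icc_right (by lia) ht)).memLp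
    have hSm : Measurable[m (k + 1)] fun ω => ∑ t ∈ Finset.Icc 1 k, δ t ω := by
      refine Finset.measurable_sum _ fun u hu => ?_
      rw [Finset.mem_Icc] at hu
      exact hδm (k + 1) u hu.1 (by lia) hk
    have hin := MemLp.integrable_inner_real hS2 hA.memLp
    have hzero := integral_inner_eq_zero (hm (k + 1)) hSm hA.1.1 hA.1.2 hin
    have hS2' := (memLp_two_iff_integrable_sq_norm hS2.1).1 hS2
    simp only [Finset.sum_Icc_succ_top (Nat.le_add_left 1 k), norm_add_sq_real]
    have hadd : Integrable (fun ω => ‖∑ t ∈ Finset.Icc 1 k, δ t ω‖ ^ 2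
        + 2 * inner ℝ (∑ t ∈ Finset.Icc 1 k, δ t ω) (δ (k + 1) ω)) μ := hS2'.add (hin.const_mul 2)
    rw [integral_add hadd hA.2.1, integral_add hS2' (hin.const_mul 2),
      integral_const_mul, hzero]
    push_cast
    linarith [ih (by lia), hA.2.2]

end Martingale

/-! ### One step at the exact projected gradient, and measurability -/

namespace CompositeProblem

variable {n : ℕ} (P : CompositeProblem n)

/-- One step of the method, in terms of the exact projected gradient. -/
theorem Psi_proj_add_le {x : Vec n} (hx : x ∈ P.X) (g : Vec n) (k : ℕ) :
    P.Psi (P.proj x g (P.step k)) + P.α ^ 2 / (8 * P.L) * ‖P.gX x‖ ^ 2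
      ≤ P.Psi x + 3 / (4 * P.L) * ‖g - P.gradf x‖ ^ 2 := by
  have hL := P.L_pos
  have hα := P.α_pos
  have h1 := P.Psi_proj_le (P.step_pos k) hx g
  have h2 : ‖P.gX x - P.PX x g (P.step k)‖ ≤ ‖g - P.gradf x‖ / P.α := by
    rw [norm_sub_rev g]
    exact P.norm_PX_sub_PX_le (P.step_pos k) hx (P.gradf x) g
  set q := P.PX x g (P.step k)
  set d := ‖g - P.gradf x‖ with hd
  have h3 : ‖P.gX x‖ ≤ ‖q‖ + d / P.α := by
    have := norm_add_le q (P.gX x - q)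
    rw [add_sub_cancel] at this
    linarith
  have h4 : ‖P.gX x‖ ^ 2 ≤ 2 * ‖q‖ ^ 2 + 2 * (d / P.α) ^ 2 := by
    nlinarith [norm_nonneg (P.gX x), norm_nonneg q, sq_nonneg (‖q‖ - d / P.α)]
  have h5 : P.α ^ 2 / (8 * P.L) * ‖P.gX x‖ ^ 2
      ≤ P.α ^ 2 / (8 * P.L) * (2 * ‖q‖ ^ 2 + 2 * (d / P.α) ^ 2) :=
    mul_le_mul_of_nonneg_left h4 (by positivity)
  have h6 : P.step k * inner ℝ (g - P.gradf x) q ≤ P.step k * (d * ‖q‖) :=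
    mul_le_mul_of_nonneg_left (real_inner_le_norm _ _) (P.step_pos k).le
  -- Of the available 3α²/(8L)·‖q‖², two thirds pay for ‖g_X‖² and one third absorbs the cross term
  -- by Young's inequality.
  have h7 : 0 ≤ (P.α * ‖q‖ - 2 * d) ^ 2 / (8 * P.L) := by positivity
  have e1 : P.α * P.step k - P.L * P.step k ^ 2 / 2 = 3 * P.α ^ 2 / (8 * P.L) := by
    rw [step]; field_simp; ring
  rw [e1] at h1
  have e2 : P.α ^ 2 / (8 * P.L) * (2 * ‖q‖ ^ 2 + 2 * (d / P.α) ^ 2)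
      + P.step k * (d * ‖q‖) + (P.α * ‖q‖ - 2 * d) ^ 2 / (8 * P.L)
      = 3 * P.α ^ 2 / (8 * P.L) * ‖q‖ ^ 2 + 3 / (4 * P.L) * d ^ 2 := by
    rw [step]; field_simp; ring
  linarith

variable {Ω Ξ : Type*}

theorem measurable_proj {m : MeasurableSpace Ω} {x g : Ω → Vec n} (hx : Measurable x)
    (hxX : ∀ ω, x ω ∈ P.X) (hg : Measurable g) {γ : ℝ} (hγ : 0 < γ) :
    Measurable fun ω => P.proj (x ω) (g ω) γ := by
  have hm : ∀ ω, (x ω, g ω) ∈ P.X ×ˢ Set.univ := fun ω => Set.mem_prod.2 ⟨hxX ω, Set.mem_univ _⟩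
  have h := (P.continuousOn_proj hγ).measurable_comp_of_mapsTo (hx.prodMk hg) hm
  simpa only using h

theorem measurable_gX_comp {m : MeasurableSpace Ω} {x : Ω → Vec n} (hx : Measurable x)
    (hxX : ∀ ω, x ω ∈ P.X) : Measurable fun ω => P.gX (x ω) :=
  P.continuousOn_gX.measurable_comp_of_mapsTo hx hxX

theorem measurableSet_le_norm_gX_sq {m : MeasurableSpace Ω} {x : Ω → Vec n} (hx : Measurable x)
    (hxX : ∀ ω, x ω ∈ P.X) (θ : ℝ) : MeasurableSet {ω | θ ≤ ‖P.gX (x ω)‖ ^ 2} :=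
  measurableSet_le measurable_const ((P.measurable_gX_comp hx hxX).norm.pow_const 2)

theorem measurable_gradf_comp {m : MeasurableSpace Ω} {x : Ω → Vec n} (hx : Measurable x)
    (hxX : ∀ ω, x ω ∈ P.X) : Measurable fun ω => P.gradf (x ω) :=
  P.continuousOn_gradf.measurable_comp_of_mapsTo hx hxX

theorem measurable_error {m : MeasurableSpace Ω} [MeasurableSpace Ξ] {G : Vec n → Ξ → Vec n}
    (hG : Measurable (Function.uncurry G)) {x : Ω → Vec n} (hx : Measurable x)
    (hxX : ∀ ω, x ω ∈ P.X) {z : Ω → Ξ} (hz : Measurable z) :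
    Measurable fun ω => G (x ω) (z ω) - P.gradf (x ω) :=
  (hG.comp (hx.prodMk hz)).sub (P.measurable_gradf_comp hx hxX)

theorem rspgIterate_mem (G : Vec n → Ξ → Vec n) (b : ℕ → ℕ) {x₁ : Vec n} (hx₁ : x₁ ∈ P.X)
    (ξ : ℕ → ℕ → Ξ) (k : ℕ) : rspgIterate P G P.step b x₁ ξ k ∈ P.X := by
  induction k using Nat.strong_induction_on with
  | _ k ih =>
    match k with
    | 0 => exact hx₁
    | 1 => exact hx₁
    | k + 2 => exact (P.proj_spec (P.step_pos _) (ih (k + 1) (by lia)) _).1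

end CompositeProblem

/-! ### A single run and its random stopping index -/

section Run

variable {n : ℕ} {Ω Ξ : Type*} {G : Vec n → Ξ → Vec n}

theorem sampleMean_sub {b : ℕ} (hb : 1 ≤ b) (x v : Vec n) (ξ : ℕ → Ξ) :
    sampleMean G b x ξ - v = (1 / (b : ℝ)) • ∑ i ∈ Finset.Icc 1 b, (G x (ξ i) - v) := by
  have hb0 : (b : ℝ) ≠ 0 := by exact_mod_cast (by lia : b ≠ 0)
  rw [sampleMean, Finset.sum_sub_distrib, smul_sub, Finset.sum_const, Nat.card_Icc,
    Nat.add_sub_cancel, ← Nat.cast_smul_eq_nsmul ℝ, smul_smul, one_div_mul_cancel hb0, one_smul]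

/-- The sum of the squared projected gradients along a run, path by path. -/
theorem sum_norm_gX_sq_le (P : CompositeProblem n) {x₁ : Vec n} (hx₁ : x₁ ∈ P.X) (b : ℕ)
    (ξ : ℕ → ℕ → Ξ) (N : ℕ) :
    ∑ k ∈ Finset.Icc 1 N, ‖P.gX (rspgIterate P G P.step (fun _ => b) x₁ ξ k)‖ ^ 2
      ≤ 8 * P.L ^ 2 * P.DPsi x₁ ^ 2 / P.α ^ 2 + 6 / P.α ^ 2 * ∑ k ∈ Finset.Icc 1 N,
        ‖sampleMean G b (rspgIterate P G P.step (fun _ => b) x₁ ξ k) (ξ k)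
          - P.gradf (rspgIterate P G P.step (fun _ => b) x₁ ξ k)‖ ^ 2 := by
  have hL := P.L_pos
  have hα := P.α_pos
  set x := rspgIterate P G P.step (fun _ => b) x₁ ξ with hx
  have hmem : ∀ k, x k ∈ P.X := P.rspgIterate_mem G _ hx₁ ξ
  -- The one-step bounds telescope from x 1 = x₁; the final value is then bounded below by Ψ*.
  have key : P.Psi (x (N + 1)) + P.α ^ 2 / (8 * P.L) * ∑ k ∈ Finset.Icc 1 N, ‖P.gX (x k)‖ ^ 2
      ≤ P.Psi x₁ + 3 / (4 * P.L) * ∑ k ∈ Finset.Icc 1 N,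
        ‖sampleMean G b (x k) (ξ k) - P.gradf (x k)‖ ^ 2 := by
    induction N with
    | zero => simp [hx, rspgIterate]
    | succ N ih =>
      rw [Finset.sum_Icc_succ_top (Nat.le_add_left 1 N),
        Finset.sum_Icc_succ_top (Nat.le_add_left 1 N)]
      have h : P.Psi (x (N + 2)) + _ ≤ _ :=
        P.Psi_proj_add_le (hmem (N + 1)) (sampleMean G b (x (N + 1)) (ξ (N + 1))) (N + 1)
      rw [mul_add, mul_add]
      linarith
  have h1 := P.PsiStar_le (hmem (N + 1))
  have h2 := P.DPsi_sq hx₁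
  set A := ∑ k ∈ Finset.Icc 1 N, ‖P.gX (x k)‖ ^ 2
  set B := ∑ k ∈ Finset.Icc 1 N, ‖sampleMean G b (x k) (ξ k) - P.gradf (x k)‖ ^ 2
  have h3 : P.α ^ 2 / (8 * P.L) * A ≤ P.L * P.DPsi x₁ ^ 2 + 3 / (4 * P.L) * B := by linarith
  refine le_of_mul_le_mul_left (h3.trans_eq ?_) (by positivity : 0 < P.α ^ 2 / (8 * P.L))
  field_simp
  ring

variable [MeasurableSpace Ξ]

theorem measurable_sampleMean {m : MeasurableSpace Ω} (hG : Measurable (Function.uncurry G))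
    {x : Ω → Vec n} (hx : Measurable x) {b : ℕ} {ξ : ℕ → Ω → Ξ}
    (hξ : ∀ i, 1 ≤ i → i ≤ b → Measurable (ξ i)) :
    Measurable fun ω => sampleMean G b (x ω) (fun i => ξ i ω) := by
  refine Measurable.const_smul (Finset.measurable_sum _ fun i hi => ?_) (1 / (b : ℝ))
  rw [Finset.mem_Icc] at hi
  exact hG.comp (hx.prodMk (hξ i hi.1 hi.2))

/-- The k-th iterate uses only the noises of iterations before k. The σ-algebra is left arbitrary,
so that the same statement serves the histories, the noise of a run and the ambient space. -/
theorem measurable_rspgIterate {m : MeasurableSpace Ω} (P : CompositeProblem n)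
    (hG : Measurable (Function.uncurry G)) {b : ℕ} {x₁ : Vec n} (hx₁ : x₁ ∈ P.X)
    {ξ : ℕ → ℕ → Ω → Ξ} (k : ℕ)
    (hξ : ∀ j i, 1 ≤ j → j < k → 1 ≤ i → i ≤ b → Measurable (ξ j i)) :
    Measurable fun ω => rspgIterate P G P.step (fun _ => b) x₁ (fun k i => ξ k i ω) k := by
  induction k using Nat.strong_induction_on with
  | _ k ih =>
    match k with
    | 0 => exact measurable_const
    | 1 => exact measurable_const
    | k + 2 =>
      have hx := ih (k + 1) (by lia) fun j i h1 h2 => hξ j i h1 (by lia)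
      exact P.measurable_proj hx (fun ω => P.rspgIterate_mem G _ hx₁ _ _)
        (measurable_sampleMean hG hx fun i => hξ (k + 1) i (by lia) (by lia)) (P.step_pos _)

theorem measurable_runHistory {b : ℕ} {ξ : ℕ → ℕ → Ω → Ξ} {k i j l : ℕ}
    (h : (1 ≤ j ∧ j < k ∧ 1 ≤ l ∧ l ≤ b) ∨ (j = k ∧ 1 ≤ l ∧ l < i)) :
    Measurable[runHistory b ξ k i] (ξ j l) := by
  refine (comap_measurable (ξ j l)).mono ?_ le_rfl
  exact le_iSup_of_le j (le_iSup_of_le l (le_iSup_of_le h le_rfl))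

theorem runHistory_le {mΩ : MeasurableSpace Ω} {b : ℕ} {ξ : ℕ → ℕ → Ω → Ξ}
    (hξ : ∀ k i, Measurable (ξ k i)) (k i : ℕ) : runHistory b ξ k i ≤ mΩ :=
  iSup_le fun j => iSup_le fun l => iSup_le fun _ => (hξ j l).comap_le

theorem measurable_runNoise {N b : ℕ} {ξ : ℕ → ℕ → Ω → Ξ} {k i : ℕ}
    (h : 1 ≤ k ∧ k ≤ N ∧ 1 ≤ i ∧ i ≤ b) : Measurable[runNoise N b ξ] (ξ k i) := by
  refine (comap_measurable (ξ k i)).mono ?_ le_rfl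
  exact le_iSup_of_le k (le_iSup_of_le i (le_iSup_of_le h le_rfl))

theorem runNoise_le {mΩ : MeasurableSpace Ω} {N b : ℕ} {ξ : ℕ → ℕ → Ω → Ξ}
    (hξ : ∀ k i, Measurable (ξ k i)) : runNoise N b ξ ≤ mΩ :=
  iSup_le fun j => iSup_le fun l => iSup_le fun _ => (hξ j l).comap_le

variable [mΩ : MeasurableSpace Ω] {μ : Measure Ω} [IsProbabilityMeasure μ]

/-- The expected sum of the squared projected gradients along a run. -/
theorem integral_norm_gX_sq_le (P : CompositeProblem n) (hG : Measurable (Function.uncurry G))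
    {x₁ : Vec n} (hx₁ : x₁ ∈ P.X) {σ : ℝ} {N b : ℕ} (hb : 1 ≤ b) {ξ : ℕ → ℕ → Ω → Ξ}
    (hξ : ∀ k i, Measurable (ξ k i)) {x : ℕ → Ω → Vec n}
    (hx : ∀ k ω, x k ω = rspgIterate P G P.step (fun _ => b) x₁ (fun k i => ξ k i ω) k)
    (hA1 : ∀ k ∈ Finset.Icc 1 N, ∀ i ∈ Finset.Icc 1 b, CallA1 μ (runHistory b ξ k i) σ
      fun ω => G (x k ω) (ξ k i ω) - P.gradf (x k ω)) :
    (∀ k ∈ Finset.Icc 1 N, Integrable (fun ω => ‖P.gX (x k ω)‖ ^ 2) μ) ∧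
      ∑ k ∈ Finset.Icc 1 N, ∫ ω, ‖P.gX (x k ω)‖ ^ 2 ∂μ
        ≤ 8 * P.L ^ 2 * P.DPsi x₁ ^ 2 / P.α ^ 2 + 6 / P.α ^ 2 * (N * (σ ^ 2 / b)) := by
  have hb0 : (0 : ℝ) < b := by exact_mod_cast hb
  have hmem : ∀ k ω, x k ω ∈ P.X := fun k ω => by rw [hx]; exact P.rspgIterate_mem G _ hx₁ _ k
  have hxm : ∀ (m : MeasurableSpace Ω) (k : ℕ),
      (∀ j i, 1 ≤ j → j < k → 1 ≤ i → i ≤ b → Measurable[m] (ξ j i)) → Measurable[m] (x k) := by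
    intro m k h
    rw [show x k = _ from funext (hx k)]
    exact measurable_rspgIterate P hG hx₁ k h
  have hδm : ∀ (m : MeasurableSpace Ω) (k i : ℕ), Measurable[m] (x k) → Measurable[m] (ξ k i) →
      Measurable[m] fun ω => G (x k ω) (ξ k i ω) - P.gradf (x k ω) :=
    fun m k i h1 h2 => P.measurable_error hG h1 (hmem k) h2
  set d : ℕ → Ω → ℝ := fun k ω =>
    ‖sampleMean G b (x k ω) (fun i => ξ k i ω) - P.gradf (x k ω)‖ ^ 2 with hd
  have hde : ∀ k, d k = fun ω => (1 / (b : ℝ)) ^ 2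
      * ‖∑ i ∈ Finset.Icc 1 b, (G (x k ω) (ξ k i ω) - P.gradf (x k ω))‖ ^ 2 := fun k => by
    funext ω
    simp only [hd]
    rw [sampleMean_sub hb, norm_smul, mul_pow, Real.norm_eq_abs, sq_abs]
  have hdint : ∀ k ∈ Finset.Icc 1 N, Integrable (d k) μ := fun k hk => by
    rw [hde]
    have h : MemLp (fun ω => ∑ i ∈ Finset.Icc 1 b, (G (x k ω) (ξ k i ω) - P.gradf (x k ω))) 2 μ :=
      memLp_finsetSum _ fun i hi => (hA1 k hk i hi).memLp
    exact ((memLp_two_iff_integrable_sq_norm h.1).1 h).const_mul _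
  -- Orthogonality is needed only inside one batch; across iterations the squared errors are merely
  -- added.
  have hdle : ∀ k ∈ Finset.Icc 1 N, ∫ ω, d k ω ∂μ ≤ σ ^ 2 / b := fun k hk => by
    have h := integral_norm_sum_sq_le (runHistory_le (b := b) hξ k)
      (δ := fun i ω => G (x k ω) (ξ k i ω) - P.gradf (x k ω))
      (fun t u h1 h2 h3 => hδm _ k u
        (hxm _ k fun j i h4 h5 h6 h7 => measurable_runHistory (Or.inl ⟨h4, h5, h6, h7⟩))
        (measurable_runHistory (Or.inr ⟨rfl, h1, h2⟩))) (hA1 k hk)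
    rw [hde, integral_const_mul]
    refine (mul_le_mul_of_nonneg_left h (by positivity)).trans_eq ?_
    field_simp
  have hpath : ∀ ω, ∑ k ∈ Finset.Icc 1 N, ‖P.gX (x k ω)‖ ^ 2
      ≤ 8 * P.L ^ 2 * P.DPsi x₁ ^ 2 / P.α ^ 2
        + 6 / P.α ^ 2 * ∑ k ∈ Finset.Icc 1 N, d k ω := fun ω => by
    simp only [hd, hx]
    exact sum_norm_gX_sq_le P hx₁ b (fun k i => ξ k i ω) N
  have hRint : Integrable (fun ω => 8 * P.L ^ 2 * P.DPsi x₁ ^ 2 / P.α ^ 2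
      + 6 / P.α ^ 2 * ∑ k ∈ Finset.Icc 1 N, d k ω) μ :=
    (integrable_const _).add ((integrable_finsetSum _ hdint).const_mul _)
  -- Integrability also comes from the pathwise bound, which dominates each single term.
  have hint : ∀ k ∈ Finset.Icc 1 N, Integrable (fun ω => ‖P.gX (x k ω)‖ ^ 2) μ := fun k hk => by
    refine hRint.mono' (((P.measurable_gX_comp (hxm _ k fun j i _ _ _ _ => hξ j i)
      (hmem k)).norm.pow_const 2).aestronglyMeasurable) (Filter.Eventually.of_forall fun ω => ?_)
    rw [Real.norm_eq_abs, abs_of_nonneg (sq_nonneg _)]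
    exact (Finset.single_le_sum (f := fun k => ‖P.gX (x k ω)‖ ^ 2)
      (fun _ _ => sq_nonneg _) hk).trans (hpath ω)
  refine ⟨hint, ?_⟩
  rw [← integral_finsetSum _ hint]
  refine (integral_mono (integrable_finsetSum _ hint) hRint hpath).trans ?_
  rw [integral_add (integrable_const _) ((integrable_finsetSum _ hdint).const_mul _),
    integral_const_mul, integral_finsetSum _ hdint, integral_const, probReal_univ, one_smul]
  gcongr
  refine (Finset.sum_le_sum hdle).trans_eq ?_
  rw [Finset.sum_const, Nat.card_Icc, Nat.add_sub_cancel, nsmul_eq_mul]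

/-- The tail of the squared projected gradient at a stopping index that is uniformly distributed
and independent of the noises of the run. -/
theorem measureReal_gX_candidate_ge_le (P : CompositeProblem n)
    (hG : Measurable (Function.uncurry G)) {x₁ : Vec n} (hx₁ : x₁ ∈ P.X) {σ : ℝ} {N b : ℕ}
    (hN : 1 ≤ N) (hb : 1 ≤ b) {ξ : ℕ → ℕ → Ω → Ξ} (hξ : ∀ k i, Measurable (ξ k i))
    {x : ℕ → Ω → Vec n}
    (hx : ∀ k ω, x k ω = rspgIterate P G P.step (fun _ => b) x₁ (fun k i => ξ k i ω) k)
    (hA1 : ∀ k ∈ Finset.Icc 1 N, ∀ i ∈ Finset.Icc 1 b, CallA1 μ (runHistory b ξ k i) σ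
      fun ω => G (x k ω) (ξ k i ω) - P.gradf (x k ω))
    {R : Ω → ℕ} (hR : ∀ ω, R ω ∈ Finset.Icc 1 N)
    (hlaw : ∀ k ∈ Finset.Icc 1 N, μ.real {ω | R ω = k} = 1 / N)
    (hind : Indep (MeasurableSpace.comap R inferInstance) (runNoise N b ξ) μ)
    {θ : ℝ} (hθ : 0 < θ) :
    μ.real {ω | θ ≤ ‖P.gX (x (R ω) ω)‖ ^ 2}
      ≤ (8 * P.L ^ 2 * P.DPsi x₁ ^ 2 / P.α ^ 2 / N + 6 / P.α ^ 2 * (σ ^ 2 / b)) / θ := by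
  have hN0 : (0 : ℝ) < N := by exact_mod_cast hN
  have hmem : ∀ k ω, x k ω ∈ P.X := fun k ω => by rw [hx]; exact P.rspgIterate_mem G _ hx₁ _ k
  obtain ⟨hint, hsum⟩ := integral_norm_gX_sq_le P hG hx₁ hb hξ hx hA1
  have hsub : {ω | θ ≤ ‖P.gX (x (R ω) ω)‖ ^ 2}
      ⊆ ⋃ k ∈ Finset.Icc 1 N, {ω | R ω = k} ∩ {ω | θ ≤ ‖P.gX (x k ω)‖ ^ 2} := fun ω hω => by
    simp only [Set.mem_iUnion, Set.mem_inter_iff, Set.mem_ofPred_eq, exists_prop] at hω ⊢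
    exact ⟨R ω, hR ω, rfl, hω⟩
  have hterm : ∀ k ∈ Finset.Icc 1 N,
      μ.real ({ω | R ω = k} ∩ {ω | θ ≤ ‖P.gX (x k ω)‖ ^ 2})
        ≤ 1 / N * ((∫ ω, ‖P.gX (x k ω)‖ ^ 2 ∂μ) / θ) := fun k hk => by
    have hxk : Measurable[runNoise N b ξ] (x k) := by
      rw [show x k = _ from funext (hx k)]
      rw [Finset.mem_Icc] at hk
      exact measurable_rspgIterate P hG hx₁ k fun j i h1 h2 h3 h4 =>
        measurable_runNoise ⟨h1, by lia, h3, h4⟩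
    have hset : MeasurableSet[runNoise N b ξ] {ω | θ ≤ ‖P.gX (x k ω)‖ ^ 2} :=
      P.measurableSet_le_norm_gX_sq hxk (hmem k) θ
    have hRset : MeasurableSet[MeasurableSpace.comap R inferInstance] {ω | R ω = k} :=
      ⟨{k}, measurableSet_singleton k, rfl⟩
    -- For a fixed k the iterate depends on the noises alone, so the probability factors; Markov's
    -- inequality handles the second factor.
    have h1 := (Indep_iff _ _ _).1 hind _ _ hRset hset
    rw [measureReal_def, h1, ENNReal.toReal_mul, ← measureReal_def, ← measureReal_def, hlaw k hk]
    gcongr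
    rw [le_div_iff₀ hθ, mul_comm]
    exact mul_meas_ge_le_integral_of_nonneg (Filter.Eventually.of_forall fun ω => sq_nonneg _)
      (hint k hk) θ
  refine (measureReal_mono hsub (measure_ne_top _ _)).trans
    ((measureReal_biUnion_finset_le _ _).trans ((Finset.sum_le_sum hterm).trans ?_))
  rw [← Finset.mul_sum, ← Finset.sum_div, ← mul_div_assoc]
  gcongr
  refine (mul_le_mul_of_nonneg_left hsum (by positivity)).trans_eq ?_
  field_simp

end Run

/-! ### Batch size, iteration limit and the bound 𝓑 -/

namespace CompositeProblem

variable {n : ℕ} (P : CompositeProblem n)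

/-- All weights equal α²/(4L), which is nonzero and cancels. -/
theorem massR_step {N : ℕ} (hN : 1 ≤ N) (k : ℕ) : P.massR P.step N k = 1 / N := by
  have hL := P.L_pos
  have hα := P.α_pos
  have hN0 : (N : ℝ) ≠ 0 := by exact_mod_cast (by lia : N ≠ 0)
  have hc : P.α * (P.α / (2 * P.L)) - P.L * (P.α / (2 * P.L)) ^ 2 ≠ 0 := by
    have : P.α * (P.α / (2 * P.L)) - P.L * (P.α / (2 * P.L)) ^ 2 = P.α ^ 2 / (4 * P.L) := by
      field_simp; ring
    rw [this]
    positivity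
  simp only [massR, step]
  rw [Finset.sum_const, Nat.card_Icc, Nat.add_sub_cancel, nsmul_eq_mul]
  field_simp

variable {σ Dt : ℝ} {Nbar : ℕ}

theorem one_le_batchSize (hN : 1 ≤ Nbar) : 1 ≤ P.batchSize σ Dt Nbar := by
  refine Nat.one_le_ceil_iff.2 (lt_min (lt_max_of_lt_left zero_lt_one) ?_)
  exact_mod_cast hN

theorem batchSize_le : P.batchSize σ Dt Nbar ≤ Nbar :=
  Nat.ceil_le.2 (min_le_right _ _)

theorem one_le_iterLimit (hN : 1 ≤ Nbar) : 1 ≤ P.iterLimit σ Dt Nbar :=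
  (Nat.one_le_div_iff (P.one_le_batchSize hN)).2 P.batchSize_le

/-- Rounding down loses at most a factor 2: N̄ < m(N + 1) ≤ 2mN because N ≥ 1. -/
theorem le_two_mul_iterLimit_mul_batchSize (hN : 1 ≤ Nbar) :
    (Nbar : ℝ) ≤ 2 * P.iterLimit σ Dt Nbar * P.batchSize σ Dt Nbar := by
  have h1 := P.one_le_iterLimit (σ := σ) (Dt := Dt) hN
  have h2 : Nbar < P.batchSize σ Dt Nbar * (P.iterLimit σ Dt Nbar + 1) :=
    Nat.lt_mul_div_succ Nbar (P.one_le_batchSize hN)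
  have h3 : Nbar ≤ 2 * P.iterLimit σ Dt Nbar * P.batchSize σ Dt Nbar := by nlinarith
  exact_mod_cast h3

/-- If the balancing value is at most 1 the ceiling is at most 1; otherwise rounding up adds at most
1 to it. Either way the constant is 1 and not 2. -/
theorem batchSize_le_add_one (hσ : 0 < σ) (hDt : 0 < Dt) :
    (P.batchSize σ Dt Nbar : ℝ) ≤ 1 + σ * √(6 * Nbar) / (4 * P.L * Dt) := by
  have hL := P.L_pos
  have hy : 0 ≤ σ * √(6 * Nbar) / (4 * P.L * Dt) := by positivity
  rcases le_total (σ * √(6 * Nbar) / (4 * P.L * Dt)) 1 with h | h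
  · have : P.batchSize σ Dt Nbar ≤ 1 := by
      refine Nat.ceil_le.2 ((min_le_left _ _).trans ?_)
      rw [max_eq_left h, Nat.cast_one]
    have h2 : (P.batchSize σ Dt Nbar : ℝ) ≤ 1 := by exact_mod_cast this
    linarith
  · have h1 : (P.batchSize σ Dt Nbar : ℝ)
        < min (max 1 (σ * √(6 * Nbar) / (4 * P.L * Dt))) (Nbar : ℝ) + 1 :=
      Nat.ceil_lt_add_one (le_min (zero_le_one.trans (le_max_left _ _)) (Nat.cast_nonneg _))
    have h2 := min_le_left (max 1 (σ * √(6 * Nbar) / (4 * P.L * Dt))) (Nbar : ℝ)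
    rw [max_eq_right h] at h1 h2
    linarith

theorem BN_pos (hσ : 0 < σ) (hDt : 0 < Dt) (hN : 1 ≤ Nbar) (x₁ : Vec n) :
    0 < P.BN σ Dt x₁ Nbar := by
  have hL := P.L_pos
  have hN0 : (0 : ℝ) < Nbar := by exact_mod_cast hN
  have : 0 < max 1 (√6 * σ / (4 * P.L * Dt * √Nbar)) := lt_max_of_lt_left zero_lt_one
  rw [BN]
  positivity

/-- The batch size and the iteration limit balance the two terms of the expected bound. -/
theorem run_bound_le_BN (hσ : 0 < σ) (hDt : 0 < Dt) (hN : 1 ≤ Nbar) (x₁ : Vec n) :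
    8 * P.L ^ 2 * P.DPsi x₁ ^ 2 / P.α ^ 2 / P.iterLimit σ Dt Nbar
      + 6 / P.α ^ 2 * (σ ^ 2 / P.batchSize σ Dt Nbar) ≤ P.L * P.BN σ Dt x₁ Nbar / P.α ^ 2 := by
  have hL := P.L_pos
  have hα := P.α_pos
  have hN0 : (0 : ℝ) < Nbar := by exact_mod_cast hN
  have hI0 : (0 : ℝ) < P.iterLimit σ Dt Nbar := by exact_mod_cast P.one_le_iterLimit hN
  have hB0 : (0 : ℝ) < P.batchSize σ Dt Nbar := by exact_mod_cast P.one_le_batchSize hN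
  have h1 := P.le_two_mul_iterLimit_mul_batchSize (σ := σ) (Dt := Dt) hN
  have h2 := P.batchSize_le_add_one (Nbar := Nbar) hσ hDt
  have h3 : min (max 1 (σ * √(6 * Nbar) / (4 * P.L * Dt))) (Nbar : ℝ)
      ≤ P.batchSize σ Dt Nbar := Nat.le_ceil _
  set I : ℝ := (P.iterLimit σ Dt Nbar : ℝ)
  set b : ℝ := (P.batchSize σ Dt Nbar : ℝ)
  rw [Real.sqrt_mul (by norm_num)] at h2 h3
  set D := P.DPsi x₁
  have hs : (Nbar : ℝ) = √Nbar ^ 2 := (Real.sq_sqrt hN0.le).symm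
  have hs0 : 0 < √(Nbar : ℝ) := Real.sqrt_pos.2 hN0
  have h6 : √6 ^ 2 = (6 : ℝ) := Real.sq_sqrt (by norm_num)
  have h60 : 0 < √(6 : ℝ) := Real.sqrt_pos.2 (by norm_num)
  rw [BN]
  set s := √(Nbar : ℝ)
  set r := √(6 : ℝ)
  -- The initial gap needs m not too large: N̄ ≤ 2Nm and the upper bound on m.
  have t1 : 8 * P.L ^ 2 * D ^ 2 / I
      ≤ P.L * (16 * P.L * D ^ 2 / Nbar + 4 * r * σ / s * (D ^ 2 / Dt)) := by
    have e : P.L * (16 * P.L * D ^ 2 / Nbar + 4 * r * σ / s * (D ^ 2 / Dt))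
        = 16 * P.L ^ 2 * D ^ 2 * (1 + σ * (r * s) / (4 * P.L * Dt)) / Nbar := by
      rw [hs]; field_simp; ring
    rw [e, div_le_div_iff₀ hI0 hN0]
    calc 8 * P.L ^ 2 * D ^ 2 * Nbar ≤ 8 * P.L ^ 2 * D ^ 2 * (2 * I * b) := by gcongr
      _ = 16 * P.L ^ 2 * D ^ 2 * b * I := by ring
      _ ≤ _ := by gcongr
  -- The variance needs m not too small. Either m reaches the balancing value or m ≥ N̄; these cases
  -- give the two entries of the maximum in 𝓑.
  have t2 : 6 * (σ ^ 2 / b)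
      ≤ P.L * (4 * r * σ / s * (Dt * max 1 (r * σ / (4 * P.L * Dt * s)))) := by
    rcases min_le_iff.1 h3 with h4 | h4
    · have h5 : σ * (r * s) / (4 * P.L * Dt) ≤ b := (le_max_right _ _).trans h4
      calc 6 * (σ ^ 2 / b) ≤ 6 * (σ ^ 2 / (σ * (r * s) / (4 * P.L * Dt))) := by gcongr
        _ = P.L * (4 * r * σ / s * (Dt * 1)) := by rw [← h6]; field_simp
        _ ≤ _ := by gcongr; exact le_max_left _ _
    · calc 6 * (σ ^ 2 / b) ≤ 6 * (σ ^ 2 / Nbar) := by gcongr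
        _ = P.L * (4 * r * σ / s * (Dt * (r * σ / (4 * P.L * Dt * s)))) := by
          rw [← h6, hs]; field_simp
        _ ≤ _ := by gcongr; exact le_max_right _ _
  have e : 8 * P.L ^ 2 * D ^ 2 / P.α ^ 2 / I + 6 / P.α ^ 2 * (σ ^ 2 / b)
      = (8 * P.L ^ 2 * D ^ 2 / I + 6 * (σ ^ 2 / b)) / P.α ^ 2 := by field_simp
  rw [e]
  gcongr
  linarith

end CompositeProblem

/-! ### The two-phase method -/

namespace TwoRSPG

variable {n : ℕ} {Ξ : Type*} [MeasurableSpace Ξ] {P : CompositeProblem n}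
  {G : Vec n → Ξ → Vec n} {σ Dt : ℝ} {x₁ : Vec n} {Nbar S T : ℕ}
  {Ω : Type*} {m : MeasurableSpace Ω} [MeasurableSpace Ω] {μ : Measure Ω} (A : TwoRSPG P G σ Dt x₁ Nbar S T μ)

/-- The information of run `s`: its stopping index and its noises. -/
@[reducible] noncomputable def runInfo (s : Fin S) : MeasurableSpace Ω :=
  MeasurableSpace.comap (A.R s) inferInstance ⊔
    runNoise (P.iterLimit σ Dt Nbar) (P.batchSize σ Dt Nbar) (A.ξ s)

theorem runInfo_le (s : Fin S) : A.runInfo s ≤ ‹MeasurableSpace Ω› :=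
  sup_le (A.measurable_R s).comap_le (runNoise_le (A.measurable_ξ s))

theorem candidate_mem (hx₁ : x₁ ∈ P.X) (s : Fin S) (ω : Ω) : A.candidate s ω ∈ P.X :=
  P.rspgIterate_mem G _ hx₁ _ _

/-- The stopping index is random, so preimages are split over its finitely many values.
Measurability with respect to the run's own information is what lets the independence of the runs be
used. -/
theorem measurable_candidate (hG : Measurable (Function.uncurry G)) (hx₁ : x₁ ∈ P.X)
    (s : Fin S) : Measurable[A.runInfo s] (A.candidate s) := by
  have hR : Measurable[A.runInfo s] (A.R s) := (comap_measurable (A.R s)).mono le_sup_left le_rfl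
  have hx : ∀ k ≤ P.iterLimit σ Dt Nbar, Measurable[A.runInfo s] (A.iterate s k) := fun k hk =>
    measurable_rspgIterate P hG hx₁ k fun j i h1 h2 h3 h4 =>
      (measurable_runNoise ⟨h1, by lia, h3, h4⟩).mono le_sup_right le_rfl
  have hsets : ∀ B : Set (Vec n), MeasurableSet B →
      MeasurableSet[A.runInfo s] (A.candidate s ⁻¹' B) := by
    intro B hB
    have e : A.candidate s ⁻¹' B = ⋃ k ∈ Finset.Icc 1 (P.iterLimit σ Dt Nbar),
        (A.R s ⁻¹' {k} ∩ A.iterate s k ⁻¹' B) := by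
      ext ω
      simp only [Set.mem_preimage, Set.mem_iUnion, Set.mem_inter_iff, Set.mem_singleton_iff,
        exists_prop, candidate]
      constructor
      · intro h
        exact ⟨A.R s ω, A.R_mem s ω, rfl, h⟩
      · rintro ⟨k, _, hk, h⟩
        rwa [hk]
    rw [e]
    refine Finset.measurableSet_biUnion _ fun k hk => ?_
    exact (hR (measurableSet_singleton k)).inter (hx k (Finset.mem_Icc.1 hk).2 hB)
  exact fun B hB => hsets B hB

theorem measurable_postError_of (hG : Measurable (Function.uncurry G))
    (hx₁ : x₁ ∈ P.X) (s : Fin S) (t : ℕ) (h1 : A.runInfo s ≤ m) (h2 : Measurable[m] (A.ζ s t)) :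
    Measurable[m] (A.postError s t) := by
  have hx : Measurable[m] (A.candidate s) := (A.measurable_candidate hG hx₁ s).mono h1 le_rfl
  exact P.measurable_error hG hx (A.candidate_mem hx₁ s) h2

theorem runInfo_le_postHistory (s : Fin S) (t : ℕ) : A.runInfo s ≤ A.postHistory s t :=
  le_sup_of_le_left (le_iSup A.runInfo s)

theorem measurable_ζ_postHistory (s : Fin S) {u t : ℕ} (h : 1 ≤ u ∧ u < t) :
    Measurable[A.postHistory s t] (A.ζ s u) := by
  refine (comap_measurable (A.ζ s u)).mono (le_sup_of_le_right ?_) le_rfl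
  exact le_iSup_of_le u (le_iSup_of_le h le_rfl)

theorem postHistory_le (s : Fin S) (t : ℕ) : A.postHistory s t ≤ ‹MeasurableSpace Ω› :=
  sup_le (iSup_le fun s' => A.runInfo_le s')
    (iSup_le fun u => iSup_le fun _ => (A.measurable_ζ s u).comap_le)

variable [IsProbabilityMeasure μ]

/-- The candidate of a run fails with probability at most `1 / 2`. -/
theorem measureReal_candidate_ge_le (hσ : 0 < σ) (hDt : 0 < Dt)
    (hG : Measurable (Function.uncurry G)) (hx₁ : x₁ ∈ P.X) (hN : 1 ≤ Nbar)
    (hA1 : A.AssumptionA1) (s : Fin S) :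
    μ.real {ω | 2 * P.L * P.BN σ Dt x₁ Nbar / P.α ^ 2 ≤ ‖P.gX (A.candidate s ω)‖ ^ 2}
      ≤ 1 / 2 := by
  have hL := P.L_pos
  have hα := P.α_pos
  have hB := P.BN_pos hσ hDt hN x₁
  -- The threshold is twice the bound on the mean, whence the probability 1/2.
  have hθ : 0 < 2 * P.L * P.BN σ Dt x₁ Nbar / P.α ^ 2 := by positivity
  have h := measureReal_gX_candidate_ge_le P hG hx₁ (P.one_le_iterLimit hN)
    (P.one_le_batchSize hN) (A.measurable_ξ s) (x := A.iterate s) (fun _ _ => rfl) (hA1.1 s)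
    (A.R_mem s) (fun k hk => (A.law_R s k hk).trans (P.massR_step (P.one_le_iterLimit hN) k))
    (A.indep_R s) hθ
  refine h.trans ((div_le_iff₀ hθ).2 ((P.run_bound_le_BN hσ hDt hN x₁).trans_eq ?_))
  ring

/-- All the candidates fail with probability at most `2 ^ (-S)`. -/
theorem measureReal_forall_candidate_ge_le (hσ : 0 < σ) (hDt : 0 < Dt)
    (hG : Measurable (Function.uncurry G)) (hx₁ : x₁ ∈ P.X) (hN : 1 ≤ Nbar)
    (hA1 : A.AssumptionA1) :
    μ.real (⋂ s, {ω | 2 * P.L * P.BN σ Dt x₁ Nbar / P.α ^ 2 ≤ ‖P.gX (A.candidate s ω)‖ ^ 2})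
      ≤ ((2 : ℝ) ^ S)⁻¹ := by
  have h := iIndep.meas_iInter A.indep_runs
    (s := fun s => {ω | 2 * P.L * P.BN σ Dt x₁ Nbar / P.α ^ 2 ≤ ‖P.gX (A.candidate s ω)‖ ^ 2})
    fun s => P.measurableSet_le_norm_gX_sq (A.measurable_candidate hG hx₁ s)
      (A.candidate_mem hx₁ s) _
  rw [measureReal_def, h, ENNReal.toReal_prod]
  refine (Finset.prod_le_prod (fun _ _ => ENNReal.toReal_nonneg)
    fun s _ => A.measureReal_candidate_ge_le hσ hDt hG hx₁ hN hA1 s).trans_eq ?_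
  rw [Finset.prod_const, Finset.card_univ, Fintype.card_fin, one_div, inv_pow]

/-- The deviation of the averaged gradient estimate at a candidate. -/
theorem measureReal_post_ge_le (hσ : 0 < σ) (hG : Measurable (Function.uncurry G))
    (hx₁ : x₁ ∈ P.X) (hT : 1 ≤ T) (hA1 : A.AssumptionA1) (hA2 : A.AssumptionA2) {lam : ℝ}
    (hlam : 0 < lam) (s : Fin S) :
    μ.real {ω | 2 * (1 + lam) ^ 2 * σ ^ 2 / T
        ≤ ‖sampleMean G T (A.candidate s ω) (fun t => A.ζ s t ω)
          - P.gradf (A.candidate s ω)‖ ^ 2} ≤ Real.exp (-lam ^ 2 / 3) := by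
  have hT0 : (0 : ℝ) < T := by exact_mod_cast hT
  -- The history contains the whole optimization phase, so the random candidate is known before its
  -- first sample and its errors are martingale differences. Only one candidate is involved, so
  -- samples may be shared.
  have h := measureReal_norm_sum_sq_ge_le hT hσ (A.postHistory_le s) (δ := A.postError s)
    (fun t => A.measurable_postError_of hG hx₁ s t (A.runInfo_le s) (A.measurable_ζ s t))
    (fun t u h1 h2 _ => A.measurable_postError_of hG hx₁ s u (A.runInfo_le_postHistory s t)
      (A.measurable_ζ_postHistory s ⟨h1, h2⟩)) (hA1.2 s) (hA2.2 s) hlam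
  refine le_trans (measureReal_mono (fun ω hω => ?_) (measure_ne_top _ _)) h
  simp only [Set.mem_ofPred_eq] at hω ⊢
  rw [sampleMean_sub hT, norm_smul, mul_pow, Real.norm_eq_abs, sq_abs, div_le_iff₀ hT0] at hω
  have h2 : 2 * (1 + lam) ^ 2 * σ ^ 2 * T
      ≤ (1 / (T : ℝ)) ^ 2 * ‖∑ t ∈ Finset.Icc 1 T, A.postError s t ω‖ ^ 2 * T * T :=
    mul_le_mul_of_nonneg_right hω hT0.le
  refine h2.trans_eq ?_
  field_simp

-- The selected candidate is compared with a single good one through the computed projected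
-- gradients. Using (a + b)² ≤ 2a² + 2b² twice gives 2(2θ + 2q/α²) + 2q/α².
omit [IsProbabilityMeasure μ] in
theorem norm_gX_output_sq_lt (hx₁ : x₁ ∈ P.X) {θ q : ℝ} {ω : Ω} {s : Fin S}
    (hs : ‖P.gX (A.candidate s ω)‖ ^ 2 < θ)
    (hq : ∀ s, ‖sampleMean G T (A.candidate s ω) (fun t => A.ζ s t ω)
      - P.gradf (A.candidate s ω)‖ ^ 2 < q) :
    ‖P.gX (A.output ω)‖ ^ 2 < 4 * θ + 6 * q / P.α ^ 2 := by
  have hα := P.α_pos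
  let g : Fin S → Vec n := fun s => sampleMean G T (A.candidate s ω) (fun t => A.ζ s t ω)
  let p : Fin S → Vec n := fun s => P.PX (A.candidate s ω) (g s) (P.α / (2 * P.L))
  let d : Fin S → ℝ := fun s => ‖g s - P.gradf (A.candidate s ω)‖ / P.α
  have hmin : ‖p (A.sel ω)‖ ≤ ‖p s‖ := A.sel_min ω s
  have hd : ∀ s, d s ^ 2 < q / P.α ^ 2 := fun s => by
    simp only [d, div_pow]
    exact div_lt_div_of_pos_right (hq s) (by positivity)
  have hγ : 0 < P.α / (2 * P.L) := P.step_pos 0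
  have h1 : ∀ s, ‖P.gX (A.candidate s ω) - p s‖ ≤ d s := fun s => by
    have := P.norm_PX_sub_PX_le hγ (A.candidate_mem hx₁ s ω) (P.gradf (A.candidate s ω)) (g s)
    rw [norm_sub_rev (P.gradf _)] at this
    exact this
  have h2 : ‖P.gX (A.output ω)‖ ≤ ‖p (A.sel ω)‖ + d (A.sel ω) := by
    have h3 := norm_add_le (p (A.sel ω)) (P.gX (A.candidate (A.sel ω) ω) - p (A.sel ω))
    rw [add_sub_cancel] at h3
    exact h3.trans (add_le_add_right (h1 _) _)
  have h4 : ‖p s‖ ≤ ‖P.gX (A.candidate s ω)‖ + d s := by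
    have h3 := norm_sub_le (P.gX (A.candidate s ω)) (P.gX (A.candidate s ω) - p s)
    rw [sub_sub_cancel] at h3
    exact h3.trans (add_le_add_right (h1 _) _)
  have h5 := hd s
  have h6 := hd (A.sel ω)
  have e : 6 * q / P.α ^ 2 = 6 * (q / P.α ^ 2) := by ring
  rw [e]
  have h7 : ‖P.gX (A.output ω)‖ ^ 2 ≤ 2 * ‖p (A.sel ω)‖ ^ 2 + 2 * d (A.sel ω) ^ 2 := by
    nlinarith [norm_nonneg (P.gX (A.output ω)), sq_nonneg (‖p (A.sel ω)‖ - d (A.sel ω))]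
  have h8 : ‖p (A.sel ω)‖ ^ 2 ≤ ‖p s‖ ^ 2 := pow_le_pow_left₀ (norm_nonneg _) hmin 2
  have h9 : ‖p s‖ ^ 2 ≤ 2 * ‖P.gX (A.candidate s ω)‖ ^ 2 + 2 * d s ^ 2 := by
    nlinarith [norm_nonneg (p s), sq_nonneg (‖P.gX (A.candidate s ω)‖ - d s)]
  linarith

/-- The large deviation bound for the output of the two-phase method. -/
theorem measureReal_output_ge_le (hσ : 0 < σ) (hDt : 0 < Dt)
    (hG : Measurable (Function.uncurry G)) (hx₁ : x₁ ∈ P.X) (hN : 1 ≤ Nbar) (hT : 1 ≤ T)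
    (hA1 : A.AssumptionA1) (hA2 : A.AssumptionA2) {lam : ℝ} (hlam : 0 < lam) :
    μ.real {ω | 8 * P.L * P.BN σ Dt x₁ Nbar / P.α ^ 2
        + 12 * (1 + lam) ^ 2 * σ ^ 2 / (T * P.α ^ 2) ≤ ‖P.gX (A.output ω)‖ ^ 2}
      ≤ S * Real.exp (-lam ^ 2 / 3) + ((2 : ℝ) ^ S)⁻¹ := by
  have hα := P.α_pos
  have hT0 : (0 : ℝ) < T := by exact_mod_cast hT
  set E : Set Ω := ⋂ s, {ω | 2 * P.L * P.BN σ Dt x₁ Nbar / P.α ^ 2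
    ≤ ‖P.gX (A.candidate s ω)‖ ^ 2} with hE
  set F : Fin S → Set Ω := fun s => {ω | 2 * (1 + lam) ^ 2 * σ ^ 2 / T
        ≤ ‖sampleMean G T (A.candidate s ω) (fun t => A.ζ s t ω)
          - P.gradf (A.candidate s ω)‖ ^ 2} with hF
  -- Outside the union some candidate is good and all estimates are accurate, so the previous
  -- comparison contradicts the event.
  have hsub : {ω | 8 * P.L * P.BN σ Dt x₁ Nbar / P.α ^ 2
        + 12 * (1 + lam) ^ 2 * σ ^ 2 / (T * P.α ^ 2) ≤ ‖P.gX (A.output ω)‖ ^ 2}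
      ⊆ (⋃ s ∈ Finset.univ, F s) ∪ E := by
    intro ω hω
    by_contra hcon
    simp only [hE, hF, Set.mem_union, Set.mem_iUnion, Set.mem_iInter, Set.mem_ofPred_eq,
      Finset.mem_univ, exists_prop, true_and, not_or, not_exists, not_forall, not_le] at hω hcon
    obtain ⟨hq, s, hs⟩ := hcon
    have h := A.norm_gX_output_sq_lt hx₁ hs hq
    refine absurd hω (not_le.2 (h.trans_eq ?_))
    field_simp
    ring
  refine (measureReal_mono hsub (measure_ne_top _ _)).trans ((measureReal_union_le _ _).trans ?_)
  refine add_le_add ((measureReal_biUnion_finset_le _ _).trans ?_)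
    (A.measureReal_forall_candidate_ge_le hσ hDt hG hx₁ hN hA1)
  refine (Finset.sum_le_sum fun s _ =>
    A.measureReal_post_ge_le hσ hG hx₁ hT hA1 hA2 hlam s).trans_eq ?_
  rw [Finset.sum_const, Finset.card_univ, Fintype.card_fin, nsmul_eq_mul]

-- A run costs m(R - 1) ≤ mN ≤ N̄ calls, the last step by integer division.
omit [IsProbabilityMeasure μ] in
theorem calls_le (ω : Ω) : A.calls ω ≤ S * (Nbar + T) := by
  have h1 : ∀ s, rspgCalls (fun _ => P.batchSize σ Dt Nbar) (A.R s ω) ≤ Nbar := fun s => by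
    have hR := Finset.mem_Icc.1 (A.R_mem s ω)
    rw [rspgCalls, Finset.sum_const, Nat.card_Icc, smul_eq_mul]
    refine (Nat.mul_le_mul_right _ (by lia : A.R s ω - 1 + 1 - 1 ≤ P.iterLimit σ Dt Nbar)).trans ?_
    exact Nat.div_mul_le_self _ _
  have h2 := Finset.sum_le_sum fun s (_ : s ∈ Finset.univ) => h1 s
  rw [Finset.sum_const, Finset.card_univ, Fintype.card_fin, smul_eq_mul] at h2
  rw [calls, Finset.sum_const, Finset.card_univ, Fintype.card_fin, smul_eq_mul, mul_add]
  lia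

end TwoRSPG

/-! ### Choice of the parameters and the order of the number of calls -/

section Parameters

theorem one_le_SOf {Lam : ℝ} (h0 : 0 < Lam) (h1 : Lam < 1) : 1 ≤ SOf Lam := by
  refine Nat.one_le_ceil_iff.2 (Real.logb_pos one_lt_two ?_)
  rw [lt_div_iff₀ h0]
  linarith

theorem inv_two_pow_SOf_le {Lam : ℝ} (h0 : 0 < Lam) : ((2 : ℝ) ^ SOf Lam)⁻¹ ≤ Lam / 2 := by
  have h : 2 / Lam ≤ (2 : ℝ) ^ SOf Lam := by
    calc 2 / Lam = (2 : ℝ) ^ Real.logb 2 (2 / Lam) :=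
          (Real.rpow_logb two_pos (by norm_num) (by positivity)).symm
      _ ≤ (2 : ℝ) ^ (SOf Lam : ℝ) := Real.rpow_le_rpow_of_exponent_le one_le_two (Nat.le_ceil _)
      _ = (2 : ℝ) ^ SOf Lam := Real.rpow_natCast _ _
  rw [← inv_div 2 Lam]
  exact inv_anti₀ (by positivity) h

/-- On [1, ∞) the binary logarithm dominates the natural one, because log 2 < 1. -/
theorem exp_neg_logb_two_le {y : ℝ} (hy : 1 ≤ y) : Real.exp (-Real.logb 2 y) ≤ y⁻¹ := by
  have hy0 : 0 < y := zero_lt_one.trans_le hy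
  have h1 : Real.log y ≤ Real.logb 2 y := by
    rw [Real.logb, le_div_iff₀ (Real.log_pos one_lt_two)]
    exact mul_le_of_le_one_right (Real.log_nonneg hy)
      (Real.log_two_lt_d9.le.trans (by norm_num))
  refine (Real.exp_le_exp.2 (neg_le_neg h1)).trans_eq ?_
  rw [Real.exp_neg, Real.exp_log hy0]

theorem two_mul_SOf_div_gt_one {Lam : ℝ} (h0 : 0 < Lam) (h1 : Lam < 1) :
    1 < 2 * SOf Lam / Lam := by
  have h2 : (1 : ℝ) ≤ SOf Lam := by exact_mod_cast one_le_SOf h0 h1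
  rw [lt_div_iff₀ h0]
  linarith

/-- With λ² = 3 log₂(2S/Λ) each deviation has probability at most Λ/(2S), so each summand is at most
Λ/2. -/
theorem failure_prob_le {Lam : ℝ} (h0 : 0 < Lam) (h1 : Lam < 1) :
    SOf Lam * Real.exp (-√(3 * Real.logb 2 (2 * SOf Lam / Lam)) ^ 2 / 3)
      + ((2 : ℝ) ^ SOf Lam)⁻¹ ≤ Lam := by
  have h2 : (1 : ℝ) ≤ SOf Lam := by exact_mod_cast one_le_SOf h0 h1
  have h3 := two_mul_SOf_div_gt_one h0 h1
  have h4 := Real.logb_pos one_lt_two h3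
  rw [Real.sq_sqrt (by positivity), show -(3 * Real.logb 2 (2 * SOf Lam / Lam)) / 3
    = -Real.logb 2 (2 * SOf Lam / Lam) by ring]
  have h5 : SOf Lam * Real.exp (-Real.logb 2 (2 * SOf Lam / Lam)) ≤ Lam / 2 := by
    refine (mul_le_mul_of_nonneg_left (exp_neg_logb_two_le h3.le) (by positivity)).trans_eq ?_
    field_simp
  linarith [inv_two_pow_SOf_le h0]

namespace CompositeProblem

variable {n : ℕ} (P : CompositeProblem n) {σ Dt ε : ℝ}

theorem one_le_NbarOf (hσ : 0 < σ) (hDt : 0 < Dt) (x₁ : Vec n) :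
    1 ≤ P.NbarOf σ Dt x₁ ε := by
  have hL := P.L_pos
  exact Nat.one_le_ceil_iff.2 (lt_max_of_lt_right (by positivity))

/-- The third entry of the maximum defining N̄(ε) makes the inner maximum in 𝓑 equal to 1; the first
two entries make the two terms at most ε/4 each. -/
theorem BN_NbarOf_le (hσ : 0 < σ) (hDt : 0 < Dt) (hε : 0 < ε) (x₁ : Vec n) :
    8 * P.L * P.BN σ Dt x₁ (P.NbarOf σ Dt x₁ ε) / P.α ^ 2 ≤ ε / 2 := by
  have hL := P.L_pos
  have hα := P.α_pos
  have hM : max (max (512 * P.L ^ 2 * P.DPsi x₁ ^ 2 / (P.α ^ 2 * ε))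
        (((Dt + P.DPsi x₁ ^ 2 / Dt) * (128 * √6 * P.L * σ / (P.α ^ 2 * ε))) ^ 2))
      (3 * σ ^ 2 / (8 * P.L ^ 2 * Dt ^ 2)) ≤ (P.NbarOf σ Dt x₁ ε : ℝ) := Nat.le_ceil _
  have hN : (0 : ℝ) < P.NbarOf σ Dt x₁ ε := by exact_mod_cast P.one_le_NbarOf hσ hDt x₁
  rw [BN]
  set M : ℝ := (P.NbarOf σ Dt x₁ ε : ℝ)
  set D := P.DPsi x₁
  obtain ⟨h12, h3⟩ := max_le_iff.1 hM
  obtain ⟨h1, h2⟩ := max_le_iff.1 h12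
  have hs0 : 0 < √M := Real.sqrt_pos.2 hN
  have hs : √M ^ 2 = M := Real.sq_sqrt hN.le
  have h6 : √6 ^ 2 = (6 : ℝ) := Real.sq_sqrt (by norm_num)
  have h60 : 0 < √(6 : ℝ) := Real.sqrt_pos.2 (by norm_num)
  have hmax : max 1 (√6 * σ / (4 * P.L * Dt * √M)) = 1 := by
    refine max_eq_left ((div_le_one (by positivity)).2 ?_)
    refine abs_le_of_sq_le_sq' ?_ (by positivity) |>.2
    rw [mul_pow, mul_pow _ (√M), h6, hs]
    rw [div_le_iff₀ (by positivity)] at h3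
    nlinarith
  rw [hmax, mul_one]
  have h2' : (Dt + D ^ 2 / Dt) * (128 * √6 * P.L * σ / (P.α ^ 2 * ε)) ≤ √M :=
    Real.le_sqrt_of_sq_le h2
  have t1 : 8 * P.L * (16 * P.L * D ^ 2 / M) / P.α ^ 2 ≤ ε / 4 := by
    rw [div_le_iff₀ (by positivity)] at h1 ⊢
    rw [← mul_div_assoc, div_le_iff₀ hN]
    nlinarith
  have t2 : 8 * P.L * (4 * √6 * σ / √M * (D ^ 2 / Dt + Dt)) / P.α ^ 2 ≤ ε / 4 := by
    have e : 8 * P.L * (4 * √6 * σ / √M * (D ^ 2 / Dt + Dt)) / P.α ^ 2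
        = (Dt + D ^ 2 / Dt) * (128 * √6 * P.L * σ / (P.α ^ 2 * ε)) * (ε / 4) / √M := by
      field_simp
      ring
    rw [e, div_le_iff₀ hs0, mul_comm (ε / 4)]
    exact mul_le_mul_of_nonneg_right h2' (by positivity)
  rw [mul_add, add_div]
  linarith

end CompositeProblem

theorem one_le_TPrimeOf {α σ ε : ℝ} (hα : 0 < α) (hσ : 0 < σ) (hε : 0 < ε) (Lam : ℝ) :
    1 ≤ TPrimeOf α σ ε Lam := by
  have h := Real.sqrt_nonneg (3 * Real.logb 2 (2 * SOf Lam / Lam))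
  exact Nat.one_le_ceil_iff.2 (by positivity)

theorem deviation_TPrimeOf_le {α σ ε : ℝ} (hα : 0 < α) (hσ : 0 < σ) (hε : 0 < ε) (Lam : ℝ) :
    12 * (1 + √(3 * Real.logb 2 (2 * SOf Lam / Lam))) ^ 2 * σ ^ 2
      / (TPrimeOf α σ ε Lam * α ^ 2) ≤ ε / 2 := by
  have h1 : 24 * σ ^ 2 / (α ^ 2 * ε) * (1 + √(3 * Real.logb 2 (2 * SOf Lam / Lam))) ^ 2
      ≤ TPrimeOf α σ ε Lam := Nat.le_ceil _
  have hT : (0 : ℝ) < TPrimeOf α σ ε Lam := by exact_mod_cast one_le_TPrimeOf hα hσ hε Lam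
  rw [div_mul_eq_mul_div, div_le_iff₀ (by positivity)] at h1
  rw [div_le_iff₀ (by positivity)]
  nlinarith

/-- For Λ ≤ 1/2 the number ℓ = log₂(1/Λ) is at least 1 and absorbs constants: S < ℓ + 2 ≤ 3ℓ. -/
theorem SOf_le {Lam : ℝ} (h0 : 0 < Lam) (h1 : Lam ≤ 1 / 2) :
    1 ≤ Real.logb 2 (1 / Lam) ∧ (SOf Lam : ℝ) ≤ 3 * Real.logb 2 (1 / Lam) := by
  have hℓ : 1 ≤ Real.logb 2 (1 / Lam) := by
    rw [Real.le_logb_iff_rpow_le one_lt_two (by positivity), Real.rpow_one, le_div_iff₀ h0]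
    linarith
  have h2 : Real.logb 2 (2 / Lam) = 1 + Real.logb 2 (1 / Lam) := by
    rw [← mul_one_div 2 Lam, Real.logb_mul two_ne_zero (by positivity),
      Real.logb_self_eq_one one_lt_two]
  have h3 : (SOf Lam : ℝ) < Real.logb 2 (2 / Lam) + 1 :=
    Nat.ceil_lt_add_one (by rw [h2]; linarith)
  exact ⟨hℓ, by linarith⟩

/-- The rough log₂ S ≤ S ≤ 3ℓ suffices: the logarithm is at most 5ℓ, and (1 + √a)² ≤ 2 + 2a with a ≤
15ℓ gives 32ℓ; finally 24·32 = 768. -/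
theorem TPrimeOf_le {α σ ε Lam : ℝ} (hα : 0 < α) (hσ : 0 < σ) (hε : 0 < ε) (h0 : 0 < Lam)
    (h1 : Lam ≤ 1 / 2) :
    (TPrimeOf α σ ε Lam : ℝ) ≤ 1 + 768 / α ^ 2 * (σ ^ 2 / ε * Real.logb 2 (1 / Lam)) := by
  obtain ⟨hℓ, hS⟩ := SOf_le h0 h1
  have hS1 : (1 : ℝ) ≤ SOf Lam := by exact_mod_cast one_le_SOf h0 (by linarith)
  have hlog := Real.logb_pos one_lt_two (two_mul_SOf_div_gt_one h0 (by linarith))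
  have h2 : Real.logb 2 (2 * SOf Lam / Lam)
      = 1 + Real.logb 2 (SOf Lam) + Real.logb 2 (1 / Lam) := by
    rw [← mul_one_div (2 * (SOf Lam : ℝ)) Lam, Real.logb_mul (by positivity) (by positivity),
      Real.logb_mul two_ne_zero (by positivity), Real.logb_self_eq_one one_lt_two]
  have h3 : Real.logb 2 (SOf Lam) ≤ SOf Lam := by
    rw [Real.logb_le_iff_le_rpow one_lt_two (by positivity), Real.rpow_natCast]
    exact_mod_cast Nat.lt_two_pow_self.le
  have h4 : (TPrimeOf α σ ε Lam : ℝ)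
      < 24 * σ ^ 2 / (α ^ 2 * ε) * (1 + √(3 * Real.logb 2 (2 * SOf Lam / Lam))) ^ 2 + 1 :=
    Nat.ceil_lt_add_one (by positivity)
  have h5 : (1 + √(3 * Real.logb 2 (2 * SOf Lam / Lam))) ^ 2 ≤ 32 * Real.logb 2 (1 / Lam) := by
    have h6 := Real.sq_sqrt (by positivity : 0 ≤ 3 * Real.logb 2 (2 * SOf Lam / Lam))
    nlinarith [sq_nonneg (1 - √(3 * Real.logb 2 (2 * SOf Lam / Lam)))]
  have h7 : 24 * σ ^ 2 / (α ^ 2 * ε) * (1 + √(3 * Real.logb 2 (2 * SOf Lam / Lam))) ^ 2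
      ≤ 24 * σ ^ 2 / (α ^ 2 * ε) * (32 * Real.logb 2 (1 / Lam)) :=
    mul_le_mul_of_nonneg_left h5 (by positivity)
  have e : 24 * σ ^ 2 / (α ^ 2 * ε) * (32 * Real.logb 2 (1 / Lam))
      = 768 / α ^ 2 * (σ ^ 2 / ε * Real.logb 2 (1 / Lam)) := by
    field_simp
    ring
  linarith

/-- Since ε ≤ 1, the rounding error is absorbed by 1/ε and the entry without ε by σ²/ε². -/
theorem CompositeProblem.NbarOf_le {n : ℕ} (P : CompositeProblem n) {σ Dt ε : ℝ} (hσ : 0 < σ)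
    (hDt : 0 < Dt) (hε : 0 < ε) (hε1 : ε ≤ 1) (x₁ : Vec n) :
    (P.NbarOf σ Dt x₁ ε : ℝ) ≤ (1 + 512 * P.L ^ 2 * P.DPsi x₁ ^ 2 / P.α ^ 2) * (1 / ε)
      + (((Dt + P.DPsi x₁ ^ 2 / Dt) * (128 * √6 * P.L / P.α ^ 2)) ^ 2
        + 3 / (8 * P.L ^ 2 * Dt ^ 2)) * (σ ^ 2 / ε ^ 2) := by
  have hL := P.L_pos
  have hα := P.α_pos
  set D := P.DPsi x₁ with hD
  set a := 512 * P.L ^ 2 * D ^ 2 / P.α ^ 2 with ha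
  set b := ((Dt + D ^ 2 / Dt) * (128 * √6 * P.L / P.α ^ 2)) ^ 2 with hb
  set c := 3 / (8 * P.L ^ 2 * Dt ^ 2) with hc
  have e1 : 512 * P.L ^ 2 * D ^ 2 / (P.α ^ 2 * ε) = a * (1 / ε) := by
    rw [ha]; field_simp
  have e2 : ((Dt + D ^ 2 / Dt) * (128 * √6 * P.L * σ / (P.α ^ 2 * ε))) ^ 2
      = b * (σ ^ 2 / ε ^ 2) := by
    rw [hb, ← div_pow, ← mul_pow]
    congr 1
    field_simp
  have e3 : 3 * σ ^ 2 / (8 * P.L ^ 2 * Dt ^ 2) = c * σ ^ 2 := by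
    rw [hc]; ring
  have h1ε : 1 ≤ 1 / ε := (one_le_div hε).2 hε1
  have hσε : σ ^ 2 ≤ σ ^ 2 / ε ^ 2 := by
    refine le_div_self (by positivity) (by positivity) (pow_le_one₀ hε.le hε1)
  have ha0 : 0 ≤ a := by positivity
  have hb0 : 0 ≤ b := by positivity
  have hc0 : 0 ≤ c := by positivity
  have hcσ : c * σ ^ 2 ≤ c * (σ ^ 2 / ε ^ 2) := mul_le_mul_of_nonneg_left hσε hc0
  have hlt : (P.NbarOf σ Dt x₁ ε : ℝ)
      < max (max (a * (1 / ε)) (b * (σ ^ 2 / ε ^ 2))) (c * σ ^ 2) + 1 := by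
    rw [← e1, ← e2, ← e3, hD]
    exact Nat.ceil_lt_add_one (le_max_of_le_right (by positivity))
  have hm : max (max (a * (1 / ε)) (b * (σ ^ 2 / ε ^ 2))) (c * σ ^ 2)
      ≤ a * (1 / ε) + b * (σ ^ 2 / ε ^ 2) + c * σ ^ 2 := by
    have h1 : 0 ≤ a * (1 / ε) := by positivity
    have h2 : 0 ≤ b * (σ ^ 2 / ε ^ 2) := by positivity
    have h3 : 0 ≤ c * σ ^ 2 := by positivity
    refine max_le (max_le ?_ ?_) ?_ <;> linarith
  linarith

/-- The order of the total number of oracle calls. -/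
theorem CompositeProblem.exists_total_calls_le {n : ℕ} (P : CompositeProblem n) (x₁ : Vec n)
    {Dt : ℝ} (hDt : 0 < Dt) :
    ∃ C : ℝ, 0 < C ∧ ∀ σ ε Lam : ℝ, 0 < σ → 0 < ε → ε ≤ 1 → 0 < Lam → Lam ≤ 1 / 2 →
      ((SOf Lam * (P.NbarOf σ Dt x₁ ε + TPrimeOf P.α σ ε Lam) : ℕ) : ℝ)
        ≤ C * (1 / ε * Real.logb 2 (1 / Lam) + σ ^ 2 / ε ^ 2 * Real.logb 2 (1 / Lam)
            + σ ^ 2 / ε * Real.logb 2 (1 / Lam) ^ 2) := by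
  have hL := P.L_pos
  have hα := P.α_pos
  set a := 1 + 512 * P.L ^ 2 * P.DPsi x₁ ^ 2 / P.α ^ 2 with ha
  set b := ((Dt + P.DPsi x₁ ^ 2 / Dt) * (128 * √6 * P.L / P.α ^ 2)) ^ 2
    + 3 / (8 * P.L ^ 2 * Dt ^ 2) with hb
  set c := 768 / P.α ^ 2 with hc
  have ha0 : 0 < a := by positivity
  have hb0 : 0 < b := by positivity
  have hc0 : 0 < c := by positivity
  -- The factor 3 is from S ≤ 3ℓ; the extra 1 next to a absorbs the rounding of T' through 1 ≤ 1/ε.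
  refine ⟨3 * (a + 1) + 3 * b + 3 * c, by positivity, ?_⟩
  intro σ ε Lam hσ hε hε1 h0 h1
  obtain ⟨hℓ, hS⟩ := SOf_le h0 h1
  have hN := P.NbarOf_le hσ hDt hε hε1 x₁
  have hT := TPrimeOf_le hα hσ hε h0 h1
  rw [← ha, ← hb] at hN
  rw [← hc] at hT
  set ℓ := Real.logb 2 (1 / Lam)
  have h1ε : 1 ≤ 1 / ε := (one_le_div hε).2 hε1
  set u := 1 / ε
  set v := σ ^ 2 / ε ^ 2 with hv
  set w := σ ^ 2 / ε with hw
  have hv0 : 0 < v := by positivity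
  have hw0 : 0 < w := by positivity
  push_cast
  calc (SOf Lam : ℝ) * (P.NbarOf σ Dt x₁ ε + TPrimeOf P.α σ ε Lam)
      ≤ 3 * ℓ * ((a * u + b * v) + (u + c * (w * ℓ))) := by
        refine mul_le_mul hS (add_le_add hN (hT.trans (by linarith))) (by positivity)
          (by positivity)
    _ = 3 * (a + 1) * (u * ℓ) + 3 * b * (v * ℓ) + 3 * c * (w * ℓ ^ 2) := by ring
    _ ≤ (3 * (a + 1) + 3 * b + 3 * c) * (u * ℓ) + (3 * (a + 1) + 3 * b + 3 * c) * (v * ℓ)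
        + (3 * (a + 1) + 3 * b + 3 * c) * (w * ℓ ^ 2) := by
        gcongr <;> linarith
    _ = _ := by ring

end Parameters

theorem mainTheorem6 {n : ℕ} (P : CompositeProblem n) (x₁ : Vec n) (hx₁ : x₁ ∈ P.X)
    (Dt : ℝ) (hDt : 0 < Dt)
    {Ξ : Type*} [MeasurableSpace Ξ] (G : Vec n → Ξ → Vec n)
    (hG : Measurable (Function.uncurry G))
    {Ω : Type*} [MeasurableSpace Ω] (μ : Measure Ω) [IsProbabilityMeasure μ] :
    (∀ σ : ℝ, 0 < σ →
      -- (a) the large deviation bound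
      (∀ Nbar S T : ℕ, 1 ≤ Nbar → 1 ≤ S → 1 ≤ T →
        ∀ A : TwoRSPG P G σ Dt x₁ Nbar S T μ, A.AssumptionA1 → A.AssumptionA2 →
        ∀ lam : ℝ, 0 < lam →
          μ.real {ω | 8 * P.L * P.BN σ Dt x₁ Nbar / P.α ^ 2
                + 12 * (1 + lam) ^ 2 * σ ^ 2 / (T * P.α ^ 2) ≤ ‖P.gX (A.output ω)‖ ^ 2}
            ≤ S * Real.exp (-lam ^ 2 / 3) + ((2 : ℝ) ^ S)⁻¹) ∧
      -- (b) the complexity of finding an (ε, Λ)-solution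
      (∀ ε Lam : ℝ, 0 < ε → 0 < Lam → Lam < 1 →
        ∀ A : TwoRSPG P G σ Dt x₁ (P.NbarOf σ Dt x₁ ε) (SOf Lam) (TPrimeOf P.α σ ε Lam) μ,
          A.AssumptionA1 → A.AssumptionA2 →
          IsEpsLamSolution P μ A.output ε Lam ∧
          ∀ ω, A.calls ω ≤ SOf Lam * (P.NbarOf σ Dt x₁ ε + TPrimeOf P.α σ ε Lam))) ∧
    -- the order of the bound in (b): the sample term depends on 1/Λ only through logarithms
    (∃ C : ℝ, 0 < C ∧ ∀ σ ε Lam : ℝ, 0 < σ → 0 < ε → ε ≤ 1 → 0 < Lam → Lam ≤ 1 / 2 →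
      ((SOf Lam * (P.NbarOf σ Dt x₁ ε + TPrimeOf P.α σ ε Lam) : ℕ) : ℝ)
        ≤ C * (1 / ε * Real.logb 2 (1 / Lam) + σ ^ 2 / ε ^ 2 * Real.logb 2 (1 / Lam)
            + σ ^ 2 / ε * Real.logb 2 (1 / Lam) ^ 2)) := by
  refine ⟨fun σ hσ => ⟨?_, ?_⟩, P.exists_total_calls_le x₁ hDt⟩
  · intro Nbar S T hN _ hT A hA1 hA2 lam hlam
    exact A.measureReal_output_ge_le hσ hDt hG hx₁ hN hT hA1 hA2 hlam
  · intro ε Lam hε h0 h1 A hA1 hA2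
    refine ⟨⟨fun ω => A.candidate_mem hx₁ _ ω, ?_⟩, A.calls_le⟩
    have hlog := Real.logb_pos one_lt_two (two_mul_SOf_div_gt_one h0 h1)
    have h := A.measureReal_output_ge_le hσ hDt hG hx₁ (P.one_le_NbarOf hσ hDt x₁)
      (one_le_TPrimeOf P.α_pos hσ hε Lam) hA1 hA2
      (Real.sqrt_pos.2 (mul_pos three_pos hlog))
    have h2 := h.trans (failure_prob_le h0 h1)
    have h3 := P.BN_NbarOf_le hσ hDt hε x₁
    have h4 := deviation_TPrimeOf_le P.α_pos hσ hε Lam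
    -- The two thresholds add up to at most ε, so the failure event of (a) covers the set where ε is
    -- exceeded. Covering the whole space avoids taking complements.
    have hcover : (1 : ℝ) ≤ μ.real {ω | ‖P.gX (A.output ω)‖ ^ 2 ≤ ε} + Lam := by
      rw [← probReal_univ (μ := μ)]
      refine (measureReal_mono (fun ω _ => ?_) (measure_ne_top _ _)).trans
        ((measureReal_union_le _ _).trans (add_le_add_right h2 _))
      rcases le_or_gt (‖P.gX (A.output ω)‖ ^ 2) ε with h5 | h5
      · exact Or.inl h5
      · exact Or.inr (le_trans (by linarith) h5.le)
    linarith
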